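/- Let $n\ge 2$ and $c\in\{-1,0,1\}$. Let $M^{n+1}_1(c)$ be the Lorentzian space form of dimension $n+1$ and curvature $c$. Here $\mathbb R^N_s$ denotes $\mathbb R^N$ with $\langle X,Y\rangle_s=-\sum_{i\le s}X_iY_i+\sum_{i>s}X_iY_i$, and - $M^{n+1}_1(0)=\mathbb R^{n+1}_1$; - $M^{n+1}_1(1)=\{p\in\mathbb R^{n+2}_1:\langle p,p\rangle_1=1\}$ (de Sitter space); - $M^{n+1}_1(-1)=\{p\in\mathbb R^{n+2}_2:\langle p,p\rangle_2=-1\}$ (anti-de Sitter space). A *spacelike hypersurface* is a smooth map $x:M^n\to M^{n+1}_1(c)$ from a smooth $n$-manifold whose induced metric $\langle dx,dx\rangle$ is positive definite. Let $\xi$ be a smooth unit normal field of $x$ in $M^{n+1}_1(c)$, $\langle\xi,\xi\rangle=-1$, and let $A$ be the shape operator, $dx(Av)=-d\xi(v)$. Its eigenvalues and eigenspaces are the principal curvatures and principal spaces. A *curvature surface* is a connected smooth (injectively immersed) submanifold $S$ of $M^n$ such that for every $p\in S$ the tangent space $T_pS$ is the principal space at $p$ of some principal curvature $\lambda(p)$.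 The spacelike hypersurface $x$ is *Dupin* if, along each curvature surface, the associated principal curvature $\lambda$ is constant. (A smooth unit normal field always exists, and the property does not depend on its choice.) A *conformal transformation* of $M^{n+1}_1(c)$, possibly only defined on an open subset $U\subseteq M^{n+1}_1(c)$, is a smooth map $\phi:U\to M^{n+1}_1(c)$ such that for every $p\in U$ there is $\mu(p)>0$ with $\langle d\phi_p X,d\phi_p Y\rangle=\mu(p)\langle X,Y\rangle$ for all $X,Y\in T_pM^{n+1}_1(c)$. **Theorem.** Let $x:M^n\to M^{n+1}_1(c)$ be a spacelike Dupin hypersurface and let $\phi$ be a conformal transformation of $M^{n+1}_1(c)$ defined on an open subset $U$ of $M^{n+1}_1(c)$ that contains $x(M^n)$ (for instance $U=M^{n+1}_1(c)$). Then $\phi\circ x:M^n\to M^{n+1}_1(c)$ is a spacelike Dupin hypersurface. -/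

import Mathlib

open scoped Manifold ContDiff

noncomputable section

namespace LorentzDupin

universe u

/-- The pseudo-Euclidean product of index `s` on `ℝ^N`: `⟨X, Y⟩_s = -∑_{i < s} Xᵢ Yᵢ + ∑_{i ≥ s} Xᵢ Yᵢ`. -/
def pseudoInner {N : ℕ} (s : ℕ) (X Y : Fin N → ℝ) : ℝ :=
  ∑ i : Fin N, (if i.val < s then -1 else 1) * (X i * Y i)

/-- Dimension of the linear space containing `M^{n+1}_1(c)`, for `c ∈ {-1, 0, 1}`:
`n + 1` for `c = 0` and `n + 2` for `c = ±1`. -/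
def ambientDim (c : SignType) (n : ℕ) : ℕ := if c = 0 then n + 1 else n + 2

/-- Index of the pseudo-Euclidean product of that linear space:
`2` for `c = -1` and `1` for `c = 0, 1`. -/
def ambientIndex (c : SignType) : ℕ := if c = -1 then 2 else 1

/-- The linear space containing `M^{n+1}_1(c)`: `ℝ^{n+1}_1` for `c = 0`, `ℝ^{n+2}_1` for `c = 1`,
`ℝ^{n+2}_2` for `c = -1`. -/
abbrev Ambient (c : SignType) (n : ℕ) : Type := Fin (ambientDim c n) → ℝ

/-- The pseudo-Euclidean product of the linear space containing `M^{n+1}_1(c)`. -/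
def ambientInner (c : SignType) (n : ℕ) (X Y : Ambient c n) : ℝ :=
  pseudoInner (ambientIndex c) X Y

/-- The Lorentzian space form `M^{n+1}_1(c)`: all of `ℝ^{n+1}_1` for `c = 0`, the de Sitter space
`{⟨p, p⟩ = 1} ⊆ ℝ^{n+2}_1` for `c = 1`, the anti-de Sitter space `{⟨p, p⟩ = -1} ⊆ ℝ^{n+2}_2`
for `c = -1`. -/
def spaceForm (c : SignType) (n : ℕ) : Set (Ambient c n) :=
  {p | c ≠ 0 → ambientInner c n p p = (c : ℝ)}

/-- The tangent space `T_p M^{n+1}_1(c)` as a set of vectors of the surrounding linear space: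
everything for `c = 0`, the vectors orthogonal to `p` for `c = ±1`. The Lorentzian metric of
`M^{n+1}_1(c)` is the restriction of `ambientInner` to it. -/
def spaceFormTangent (c : SignType) (n : ℕ) (p : Ambient c n) : Set (Ambient c n) :=
  {X | c ≠ 0 → ambientInner c n p X = 0}

/-- `φ` is a conformal transformation of `M^{n+1}_1(c)` with domain `U`: the set `U` is open in
`M^{n+1}_1(c)`, and `φ` is a smooth map from `U` to `M^{n+1}_1(c)` that multiplies the Lorentzian
metric by a positive function. On the tangent vectors of `M^{n+1}_1(c)` at a point of `U`
the derivative of `φ` within `U` is the (unique) differential of `φ : U → M^{n+1}_1(c)`. -/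
structure IsConformalTransformation (c : SignType) (n : ℕ) (U : Set (Ambient c n))
    (φ : Ambient c n → Ambient c n) : Prop where
  isOpen_domain : ∃ W : Set (Ambient c n), IsOpen W ∧ U = W ∩ spaceForm c n
  smooth : ContDiffOn ℝ ∞ φ U
  mapsTo : Set.MapsTo φ U (spaceForm c n)
  conformal : ∀ p ∈ U, ∃ μ : ℝ, 0 < μ ∧
    ∀ X ∈ spaceFormTangent c n p, ∀ Y ∈ spaceFormTangent c n p,
      ambientInner c n (fderivWithin ℝ φ U p X) (fderivWithin ℝ φ U p Y)
        = μ * ambientInner c n X Y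

section Hypersurface

variable {c : SignType} {n : ℕ}
  {M : Type u} [TopologicalSpace M] [ChartedSpace (EuclideanSpace ℝ (Fin n)) M]

/-- The differential at `p` of a map from an `n`-manifold to the linear space containing
`M^{n+1}_1(c)`. -/
def differential (f : M → Ambient c n) (p : M) : TangentSpace (𝓡 n) p →ₗ[ℝ] Ambient c n :=
  (mfderiv (𝓡 n) 𝓘(ℝ, Ambient c n) f p).toLinearMap

/-- `x : M → M^{n+1}_1(c)` is a spacelike hypersurface: it is smooth and the induced metric
`⟨dx, dx⟩` is positive definite (so that `x` is an immersion). -/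
structure IsSpacelikeHypersurface (x : M → Ambient c n) : Prop where
  smooth : ContMDiff (𝓡 n) 𝓘(ℝ, Ambient c n) ∞ x
  mem : ∀ p, x p ∈ spaceForm c n
  spacelike : ∀ p, ∀ v : TangentSpace (𝓡 n) p, v ≠ 0 →
    0 < ambientInner c n (differential x p v) (differential x p v)

/-- `ξ` is a smooth unit normal field of the spacelike hypersurface `x` in `M^{n+1}_1(c)`;
it is timelike, `⟨ξ, ξ⟩ = -1`. -/
structure IsUnitNormal (x ξ : M → Ambient c n) : Prop where
  smooth : ContMDiff (𝓡 n) 𝓘(ℝ, Ambient c n) ∞ ξ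
  tangent : ∀ p, ξ p ∈ spaceFormTangent c n (x p)
  normal : ∀ p, ∀ v : TangentSpace (𝓡 n) p, ambientInner c n (ξ p) (differential x p v) = 0
  unit : ∀ p, ambientInner c n (ξ p) (ξ p) = -1

/-- The shape operator at `p` of the spacelike hypersurface `x` with unit normal field `ξ`:
the endomorphism `A` of `T_p M` such that `dx (A v) = -dξ v`. -/
def shapeOperator (x ξ : M → Ambient c n) (p : M) : Module.End ℝ (TangentSpace (𝓡 n) p) :=
  (differential x p).leftInverse ∘ₗ (-differential ξ p)

/-- `ambientInner` as a bilinear map. -/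
def ambientBilin (c : SignType) (n : ℕ) : Ambient c n →ₗ[ℝ] Ambient c n →ₗ[ℝ] ℝ :=
  LinearMap.mk₂ ℝ (ambientInner c n)
    (by intros; simp [ambientInner, pseudoInner, add_mul, mul_add, Finset.sum_add_distrib])
    (by intros; simp [ambientInner, pseudoInner, Finset.mul_sum]; congr 1; ext; ring)
    (by intros; simp [ambientInner, pseudoInner, add_mul, mul_add, Finset.sum_add_distrib])
    (by intros; simp [ambientInner, pseudoInner, Finset.mul_sum]; congr 1; ext; ring)

lemma ambientBilin_apply (X Y) : ambientBilin c n X Y = ambientInner c n X Y := rfl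
lemma ambientBilin_comm (X Y) : ambientBilin c n X Y = ambientBilin c n Y X := by
  simp [ambientBilin_apply, ambientInner, pseudoInner, mul_comm]

/-- The product rule for functions `⟨f, g⟩` that are constant. -/
lemma ambientBilin_differential (f g : M → Ambient c n) (hf : ContMDiff (𝓡 n) 𝓘(ℝ, Ambient c n) ∞ f)
    (hg : ContMDiff (𝓡 n) 𝓘(ℝ, Ambient c n) ∞ g) (k : ℝ)
    (h : ∀ p, ambientBilin c n (f p) (g p) = k) (p : M) (v : TangentSpace (𝓡 n) p) :
    ambientBilin c n (f p) (differential g p v) + ambientBilin c n (differential f p v) (g p) = 0 := by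
  have hB : IsBoundedBilinearMap ℝ (fun q : Ambient c n × Ambient c n => ambientBilin c n q.1 q.2) :=
    (LinearMap.toContinuousBilinearMap (ambientBilin c n)).isBoundedBilinearMap
  have h1 := ((hf p).mdifferentiableAt (by simp)).hasMFDerivAt
  have h2 := ((hg p).mdifferentiableAt (by simp)).hasMFDerivAt
  have h12 : HasMFDerivAt (𝓡 n) 𝓘(ℝ, Ambient c n × Ambient c n) (fun y => (f y, g y)) p
      ((mfderiv (𝓡 n) 𝓘(ℝ, Ambient c n) f p).prod (mfderiv (𝓡 n) 𝓘(ℝ, Ambient c n) g p)) :=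
    ⟨h1.1.prodMk h2.1, h1.2.prodMk h2.2⟩
  have h3 := HasMFDerivAt.comp p (g := fun q : Ambient c n × Ambient c n => ambientBilin c n q.1 q.2)
    (hB.hasFDerivAt (f p, g p)).hasMFDerivAt h12
  have h4 : ((fun q : Ambient c n × Ambient c n => ambientBilin c n q.1 q.2) ∘ fun x => (f x, g x))
    = fun _ => k := by ext q; exact h q
  rw [h4] at h3
  have := hasMFDerivAt_unique h3 (hasMFDerivAt_const k p)
  have := congrArg (fun L => L v) this
  exact this

/-- The characterization of the shape operator: `dx (A v) = -dξ v`. -/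
lemma shapeOperator_spec {x ξ : M → Ambient c n} (hx : IsSpacelikeHypersurface x)
    (hξ : IsUnitNormal x ξ) (p : M) (v : TangentSpace (𝓡 n) p) :
    differential x p (shapeOperator x ξ p v) = - differential ξ p v := by
  have hinj : LinearMap.ker (differential x p) = ⊥ := by
    rw [LinearMap.ker_eq_bot']
    intro w hw
    by_contra h0
    have := hx.spacelike p w h0
    rw [hw] at this
    simp [ambientInner, pseudoInner] at this
  suffices h : ∃ w, differential x p w = - differential ξ p v by
    obtain ⟨w, hw⟩ := h
    simp only [shapeOperator, LinearMap.comp_apply, LinearMap.neg_apply]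
    rw [← hw, LinearMap.leftInverse_apply_of_inj hinj]
  have e1 : ambientBilin c n (ξ p) (differential ξ p v) = 0 := by
    have := ambientBilin_differential ξ ξ hξ.smooth hξ.smooth (-1) hξ.unit p v
    rw [ambientBilin_comm (differential ξ p v)] at this
    linarith
  have e0 : ambientBilin c n (ξ p) (ξ p) = -1 := hξ.unit p
  have en : ∀ w, ambientBilin c n (ξ p) (differential x p w) = 0 := hξ.normal p
  have hfr : Module.finrank ℝ (TangentSpace (𝓡 n) p) = n := by
    change Module.finrank ℝ (EuclideanSpace ℝ (Fin n)) = n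
    simp
  have : FiniteDimensional ℝ (TangentSpace (𝓡 n) p) :=
    inferInstanceAs (FiniteDimensional ℝ (EuclideanSpace ℝ (Fin n)))
  have hz : ∀ w, differential x p w = 0 → w = 0 := LinearMap.ker_eq_bot'.1 hinj
  by_cases hc : c = 0
  · let L : (TangentSpace (𝓡 n) p × ℝ) →ₗ[ℝ] Ambient c n :=
      (differential x p).coprod (LinearMap.toSpanSingleton ℝ _ (ξ p))
    have hL : ∀ w a, L (w, a) = differential x p w + a • ξ p := fun w a => by simp [L]
    have hLi : Function.Injective L := by
      rw [← LinearMap.ker_eq_bot, LinearMap.ker_eq_bot']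
      rintro ⟨w, a⟩ h
      rw [hL] at h
      have := congrArg (ambientBilin c n (ξ p)) h
      simp [en, e0] at this
      subst this
      simp at h
      simp [hz w h]
    have hLs := (LinearMap.injective_iff_surjective_of_finrank_eq_finrank (by
      rw [Module.finrank_prod, hfr]; simp [ambientDim, hc])).1 hLi
    obtain ⟨⟨w, a⟩, h⟩ := hLs (- differential ξ p v)
    rw [hL] at h
    have := congrArg (ambientBilin c n (ξ p)) h
    simp [en, e0, e1] at this
    subst this
    exact ⟨w, by simpa using h⟩
  · have hcR : (c : ℝ) ≠ 0 := by cases c <;> simp_all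
    have f0 : ambientBilin c n (x p) (x p) = (c : ℝ) := hx.mem p hc
    have fn : ∀ w, ambientBilin c n (x p) (differential x p w) = 0 := fun w => by
      have := ambientBilin_differential x x hx.smooth hx.smooth (c : ℝ) (fun q => hx.mem q hc) p w
      rw [ambientBilin_comm (differential x p w)] at this
      linarith
    have fx : ambientBilin c n (x p) (ξ p) = 0 := hξ.tangent p hc
    have fx' : ambientBilin c n (ξ p) (x p) = 0 := by rw [ambientBilin_comm, fx]
    have f1 : ambientBilin c n (x p) (differential ξ p v) = 0 := by
      have := ambientBilin_differential x ξ hx.smooth hξ.smooth 0 (fun q => hξ.tangent q hc) p v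
      rw [ambientBilin_comm (differential x p v), en] at this
      linarith
    let L : (TangentSpace (𝓡 n) p × ℝ × ℝ) →ₗ[ℝ] Ambient c n :=
      (differential x p).coprod
        ((LinearMap.toSpanSingleton ℝ _ (ξ p)).coprod (LinearMap.toSpanSingleton ℝ _ (x p)))
    have hL : ∀ w a b, L (w, a, b) = differential x p w + (a • ξ p + b • x p) :=
      fun w a b => by simp [L]
    have hLi : Function.Injective L := by
      rw [← LinearMap.ker_eq_bot, LinearMap.ker_eq_bot']
      rintro ⟨w, a, b⟩ h
      rw [hL] at h
      have h1 := congrArg (ambientBilin c n (ξ p)) h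
      have h2 := congrArg (ambientBilin c n (x p)) h
      simp [en, e0, fx'] at h1
      simp [fn, f0, fx, hcR] at h2
      have h2' : b = 0 := by first | exact h2 | exact h2.resolve_right hcR
      subst h1 h2'
      simp at h
      simp [hz w h]
    have hLs := (LinearMap.injective_iff_surjective_of_finrank_eq_finrank (by
      rw [Module.finrank_prod, hfr]; simp [ambientDim, hc])).1 hLi
    obtain ⟨⟨w, a, b⟩, h⟩ := hLs (- differential ξ p v)
    rw [hL] at h
    have h1 := congrArg (ambientBilin c n (ξ p)) h
    have h2 := congrArg (ambientBilin c n (x p)) h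
    simp [en, e0, e1, fx'] at h1
    simp [fn, f0, fx, f1] at h2
    have h2' : b = 0 := by first | exact h2 | exact h2.resolve_right hcR
    subst h1 h2'
    exact ⟨w, by simpa using h⟩

/-- `ι : S → M` exhibits the connected `m`-manifold `S` as a curvature surface, with associated
principal curvature `l`, of the hypersurface `x` with unit normal field `ξ`: it is a submanifold
(an injective immersion), and at each of its points its tangent space is the principal space of
the principal curvature `l`, i.e. the eigenspace of the eigenvalue `l` of the shape operator. -/
structure IsCurvatureSurface (x ξ : M → Ambient c n) (m : ℕ) {S : Type u} [TopologicalSpace S]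
    [ChartedSpace (EuclideanSpace ℝ (Fin m)) S] (ι : S → M) (l : S → ℝ) : Prop where
  isImmersion : Manifold.IsImmersion (𝓡 m) (𝓡 n) ∞ ι
  injective : Function.Injective ι
  principalCurvature : ∀ s, (shapeOperator x ξ (ι s)).HasEigenvalue (l s)
  tangentSpace_eq : ∀ s,
    LinearMap.range (mfderiv (𝓡 m) (𝓡 n) ι s).toLinearMap
      = (shapeOperator x ξ (ι s)).eigenspace (l s)

/-- `x : M → M^{n+1}_1(c)` is a spacelike Dupin hypersurface: it is a spacelike hypersurface and,
for its principal curvatures with respect to a unit normal field, the principal curvature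
associated with a curvature surface is constant along that curvature surface.
A spacelike hypersurface of `M^{n+1}_1(c)` always has a unit normal field, as `M^{n+1}_1(c)` is
time-orientable; another choice changes the signs of the principal curvatures, the same sign all
along a connected set, so the choice does not matter. -/
def IsSpacelikeDupin (x : M → Ambient c n) : Prop :=
  IsSpacelikeHypersurface x ∧
    ∃ ξ : M → Ambient c n, IsUnitNormal x ξ ∧
      ∀ (m : ℕ) (S : Type u) [TopologicalSpace S] [ChartedSpace (EuclideanSpace ℝ (Fin m)) S]
        [IsManifold (𝓡 m) ∞ S] [ConnectedSpace S] (ι : S → M) (l : S → ℝ),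
        IsCurvatureSurface x ξ m ι l → ∀ s t : S, l s = l t

end Hypersurface

end LorentzDupin

end

/-! Write `f = η^(-1/2)` for the inverse scale of a conformal map `Φ` with factor `η`. The point is
a Liouville-type rigidity: the Hessians of `f` and of `f Φ` vanish on orthogonal pairs `X`, `Y` of
tangent vectors, provided some non-null tangent `Z` is orthogonal to both
(`IsConformalExtension.second_deriv_eq_zero`).

For the rigidity, lift `Φ` to a map `ν` into the light cone of a flat space with two more
dimensions. As `ν` is null and orthogonal to its derivatives, rescaling to `f ν` turns the conformal
map into an isometric one. If `c ≠ 0`, the map is first extended by homogeneity to the surrounding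
linear space, and a summand `k` restores the lost radial part of the metric. So `Ψ = f ν + k` is an
isometric immersion of a flat space in codimension two with null normal `ν`. For orthogonal `X`, `Y`
the normal vector `∂_X ∂_Y Ψ` is a multiple of `ν`, and the Gauss equation against `Z` forces the
multiple to be zero (`isometric_second_deriv_eq_zero`). The coordinates of `Ψ` contain `f` and `f
Φ`.

Apply this with `X = dx v` and `Y = ξ`; a suitable `Z = dx w` exists because `n ≥ 2`. The unit
normal `f dΦ(ξ) = d(f Φ)(ξ) - df(ξ) Φ` of `Φ ∘ x` can then be differentiated without Hessian terms,
and the shape operator becomes `f A + df(ξ) I` (`IsConformalExtension.shapeOperator_comp`).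
Principal spaces, hence curvature surfaces, are unchanged, and `λ` becomes `f λ + df(ξ)`. Where `λ`
is a constant `a`, the derivative along a principal vector `v` is `a df(dx v) + df(dξ v) = 0`, since
`dξ v = -a dx v` (`IsConformalExtension.principalCurvature_const`). -/

noncomputable section

namespace LorentzDupin

/-! ### Derivatives in constant directions. -/

section Calculus

variable {E F G H : Type*} [NormedAddCommGroup E] [NormedSpace ℝ E]
  [NormedAddCommGroup F] [NormedSpace ℝ F] [NormedAddCommGroup G] [NormedSpace ℝ G]
  [NormedAddCommGroup H] [NormedSpace ℝ H] {Ω : Set E}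

/-- The derivative of `f` in the constant direction `X`. -/
def dirDeriv (X : E) (f : E → F) (q : E) : F := fderiv ℝ f q X

lemma differentiableAt_of_contDiffOn (hΩ : IsOpen Ω) {f : E → F} (hf : ContDiffOn ℝ ∞ f Ω) {q : E}
    (hq : q ∈ Ω) : DifferentiableAt ℝ f q :=
  (hf.contDiffAt (hΩ.mem_nhds hq)).differentiableAt (by simp)

lemma contDiffOn_fderiv (hΩ : IsOpen Ω) {f : E → F} (hf : ContDiffOn ℝ ∞ f Ω) :
    ContDiffOn ℝ ∞ (fderiv ℝ f) Ω :=
  hf.fderiv_of_isOpen hΩ (by simp)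

lemma contDiffOn_dirDeriv (hΩ : IsOpen Ω) {f : E → F} (hf : ContDiffOn ℝ ∞ f Ω) (X : E) :
    ContDiffOn ℝ ∞ (dirDeriv X f) Ω :=
  (contDiffOn_fderiv hΩ hf).clm_apply contDiffOn_const

lemma dirDeriv_congr (hΩ : IsOpen Ω) {f g : E → F} (h : Set.EqOn f g Ω) {q : E} (hq : q ∈ Ω)
    (X : E) : dirDeriv X f q = dirDeriv X g q := by
  unfold dirDeriv
  rw [(h.eventuallyEq_of_mem (hΩ.mem_nhds hq)).fderiv_eq]

lemma dirDeriv_dirDeriv (hΩ : IsOpen Ω) {f : E → F} (hf : ContDiffOn ℝ ∞ f Ω) {q : E} (hq : q ∈ Ω)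
    (X Y : E) : dirDeriv X (dirDeriv Y f) q = fderiv ℝ (fderiv ℝ f) q X Y := by
  have := differentiableAt_of_contDiffOn hΩ (contDiffOn_fderiv hΩ hf) hq
  change fderiv ℝ (fun q => fderiv ℝ f q Y) q X = _
  rw [fderiv_clm_apply this (by fun_prop)]
  simp

lemma dirDeriv_comm (hΩ : IsOpen Ω) {f : E → F} (hf : ContDiffOn ℝ ∞ f Ω) {q : E} (hq : q ∈ Ω)
    (X Y : E) : dirDeriv X (dirDeriv Y f) q = dirDeriv Y (dirDeriv X f) q := by
  rw [dirDeriv_dirDeriv hΩ hf hq, dirDeriv_dirDeriv hΩ hf hq]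
  have h : ContDiffAt ℝ ∞ f q := hf.contDiffAt (hΩ.mem_nhds hq)
  exact (h.isSymmSndFDerivAt (by simpa using WithTop.coe_le_coe.2 (le_top : (2 : ℕ∞) ≤ ⊤))) X Y

lemma dirDeriv_const (X : E) (a : F) (q : E) : dirDeriv X (fun _ => a) q = 0 := by
  simp [dirDeriv]

lemma dirDeriv_add {f g : E → F} {q : E} (hf : DifferentiableAt ℝ f q)
    (hg : DifferentiableAt ℝ g q) (X : E) :
    dirDeriv X (fun q => f q + g q) q = dirDeriv X f q + dirDeriv X g q := by
  unfold dirDeriv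
  rw [fderiv_fun_add hf hg]; rfl

lemma dirDeriv_smul {f : E → ℝ} {g : E → F} {q : E} (hf : DifferentiableAt ℝ f q)
    (hg : DifferentiableAt ℝ g q) (X : E) :
    dirDeriv X (fun q => f q • g q) q = f q • dirDeriv X g q + dirDeriv X f q • g q := by
  unfold dirDeriv
  rw [fderiv_fun_smul hf hg]; simp

lemma dirDeriv_linearMap [FiniteDimensional ℝ F] (l : F →ₗ[ℝ] G) {f : E → F} {q : E}
    (hf : DifferentiableAt ℝ f q) (X : E) :
    dirDeriv X (fun q => l (f q)) q = l (dirDeriv X f q) := by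
  have h := (l.toContinuousLinearMap.hasFDerivAt (x := f q)).comp q hf.hasFDerivAt
  exact congrArg (fun T => T X) h.fderiv

lemma hasFDerivAt_bilin [FiniteDimensional ℝ F] [FiniteDimensional ℝ G] (A : F →ₗ[ℝ] G →ₗ[ℝ] H)
    (a : F × G) : HasFDerivAt (fun q : F × G => A q.1 q.2)
      ((LinearMap.toContinuousBilinearMap A).isBoundedBilinearMap.deriv a) a :=
  (LinearMap.toContinuousBilinearMap A).isBoundedBilinearMap.hasFDerivAt a

lemma dirDeriv_bilin [FiniteDimensional ℝ F] [FiniteDimensional ℝ G] (A : F →ₗ[ℝ] G →ₗ[ℝ] H)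
    {f : E → F} {g : E → G} {q : E} (hf : DifferentiableAt ℝ f q) (hg : DifferentiableAt ℝ g q)
    (X : E) :
    dirDeriv X (fun q => A (f q) (g q)) q
      = A (f q) (dirDeriv X g q) + A (dirDeriv X f q) (g q) := by
  have h := (hasFDerivAt_bilin A (f q, g q)).comp q (hf.hasFDerivAt.prodMk hg.hasFDerivAt)
  exact congrArg (fun T => T X) h.fderiv

lemma contDiffOn_bilin [FiniteDimensional ℝ F] [FiniteDimensional ℝ G] (A : F →ₗ[ℝ] G →ₗ[ℝ] H)
    {f : E → F} {g : E → G} (hf : ContDiffOn ℝ ∞ f Ω) (hg : ContDiffOn ℝ ∞ g Ω) :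
    ContDiffOn ℝ ∞ (fun q => A (f q) (g q)) Ω :=
  (LinearMap.toContinuousBilinearMap A).isBoundedBilinearMap.contDiff.comp_contDiffOn
    (hf.prodMk hg)

end Calculus

/-! ### Isometric immersions of flat spaces into flat spaces. -/

section Isometric

variable {E W : Type*} [NormedAddCommGroup E] [NormedSpace ℝ E]
  [NormedAddCommGroup W] [NormedSpace ℝ W] [FiniteDimensional ℝ W]
  {B : E →ₗ[ℝ] E →ₗ[ℝ] ℝ} {C : W →ₗ[ℝ] W →ₗ[ℝ] ℝ} {Ω : Set E} {Ψ : E → W}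

/-- The second derivative of an isometric immersion of a flat space is normal. -/
lemma isometric_second_deriv_normal (hΩ : IsOpen Ω) (hC : ∀ u w, C u w = C w u)
    (hΨ : ContDiffOn ℝ ∞ Ψ Ω)
    (hiso : ∀ q ∈ Ω, ∀ X Y, C (dirDeriv X Ψ q) (dirDeriv Y Ψ q) = B X Y)
    {q : E} (hq : q ∈ Ω) (X Y Z : E) :
    C (dirDeriv Z (dirDeriv X Ψ) q) (dirDeriv Y Ψ q) = 0 := by
  have key : ∀ X Y Z, C (dirDeriv Z (dirDeriv X Ψ) q) (dirDeriv Y Ψ q)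
      = - C (dirDeriv Z (dirDeriv Y Ψ) q) (dirDeriv X Ψ q) := by
    intro X Y Z
    have h := dirDeriv_congr hΩ (fun q hq => hiso q hq X Y) hq Z
    rw [dirDeriv_bilin C
      (differentiableAt_of_contDiffOn hΩ (contDiffOn_dirDeriv hΩ hΨ X) hq)
      (differentiableAt_of_contDiffOn hΩ (contDiffOn_dirDeriv hΩ hΨ Y) hq), dirDeriv_const,
      hC (dirDeriv X Ψ q)] at h
    linarith
  have sym : ∀ X Z, dirDeriv Z (dirDeriv X Ψ) q = dirDeriv X (dirDeriv Z Ψ) q :=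
    fun X Z => dirDeriv_comm hΩ hΨ hq Z X
  -- The expression is symmetric in `X`, `Z` and skew in `X`, `Y`; as for the Levi-Civita
  -- connection, three alternating swaps return it to minus itself.
  have h1 := key X Y Z
  have h2 := key Z X Y
  have h3 := key Y Z X
  rw [sym Y Z] at h1
  rw [sym X Y] at h2
  rw [sym Z X] at h3
  linarith

/-- The Gauss equation of an isometric immersion of a flat space. -/
lemma isometric_gauss (hΩ : IsOpen Ω) (hC : ∀ u w, C u w = C w u)
    (hΨ : ContDiffOn ℝ ∞ Ψ Ω)
    (hiso : ∀ q ∈ Ω, ∀ X Y, C (dirDeriv X Ψ q) (dirDeriv Y Ψ q) = B X Y)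
    {q : E} (hq : q ∈ Ω) (X Y Z : E) :
    C (dirDeriv X (dirDeriv Y Ψ) q) (dirDeriv Z (dirDeriv Z Ψ) q)
      = C (dirDeriv X (dirDeriv Z Ψ) q) (dirDeriv Y (dirDeriv Z Ψ) q) := by
  have hd : ∀ X, ContDiffOn ℝ ∞ (dirDeriv X Ψ) Ω := contDiffOn_dirDeriv hΩ hΨ
  have h : ∀ Y T, C (dirDeriv Y (dirDeriv X Ψ) q) (dirDeriv T (dirDeriv Z Ψ) q)
      = - C (dirDeriv T (dirDeriv Y (dirDeriv X Ψ)) q) (dirDeriv Z Ψ q) := by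
    intro Y T
    have h := dirDeriv_congr hΩ
      (fun q hq => isometric_second_deriv_normal hΩ hC hΨ hiso hq X Z Y) hq T
    rw [dirDeriv_bilin C
      (differentiableAt_of_contDiffOn hΩ (contDiffOn_dirDeriv hΩ (hd X) Y) hq)
      (differentiableAt_of_contDiffOn hΩ (hd Z) hq), dirDeriv_const] at h
    linarith
  -- Both sides equal minus the tangential component of the third derivative in `X`, `Y`, `Z` along
  -- `∂_Z Ψ`, because third derivatives commute.
  rw [dirDeriv_comm hΩ hΨ hq X Y, dirDeriv_comm hΩ hΨ hq X Z, h Y Z, h Z Y,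
    dirDeriv_comm hΩ (hd X) hq Z Y]

/-- For an isometric immersion `Ψ` of a flat space in codimension two with a null normal field `ν`,
`∂_X ∂_Y Ψ` vanishes if some `Z` is orthogonal to `X`, `Y` for the second fundamental form in the
direction `ν`. -/
lemma isometric_second_deriv_eq_zero [FiniteDimensional ℝ E] (hΩ : IsOpen Ω)
    (hB : ∀ X, (∀ Y, B X Y = 0) → X = 0)
    (hC : ∀ u w, C u w = C w u) (hCn : ∀ u, (∀ w, C u w = 0) → u = 0)
    (hdim : Module.finrank ℝ W = Module.finrank ℝ E + 2)
    (hΨ : ContDiffOn ℝ ∞ Ψ Ω)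
    (hiso : ∀ q ∈ Ω, ∀ X Y, C (dirDeriv X Ψ q) (dirDeriv Y Ψ q) = B X Y)
    {ν : E → W} (hν : ContDiffOn ℝ ∞ ν Ω)
    (hν0 : ∀ q ∈ Ω, ν q ≠ 0) (hνν : ∀ q ∈ Ω, C (ν q) (ν q) = 0)
    (hνΨ : ∀ q ∈ Ω, ∀ X, C (dirDeriv X Ψ q) (ν q) = 0)
    {q : E} (hq : q ∈ Ω) (X Y Z : E)
    (hXY : C (dirDeriv Y Ψ q) (dirDeriv X ν q) = 0)
    (hXZ : C (dirDeriv Z Ψ q) (dirDeriv X ν q) = 0)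
    (hYZ : C (dirDeriv Z Ψ q) (dirDeriv Y ν q) = 0)
    (hZZ : C (dirDeriv Z Ψ q) (dirDeriv Z ν q) ≠ 0) :
    dirDeriv X (dirDeriv Y Ψ) q = 0 := by
  have hdiff : ∀ X Y, C (dirDeriv X (dirDeriv Y Ψ) q) (ν q)
      = - C (dirDeriv Y Ψ q) (dirDeriv X ν q) := by
    intro X Y
    have h := dirDeriv_congr hΩ (fun q hq => hνΨ q hq Y) hq X
    rw [dirDeriv_bilin C (differentiableAt_of_contDiffOn hΩ (contDiffOn_dirDeriv hΩ hΨ Y) hq)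
      (differentiableAt_of_contDiffOn hΩ hν hq), dirDeriv_const] at h
    linarith
  -- The range of `T` is the tangent space plus the line of `ν`, of codimension one in `W`. Its
  -- orthogonal complement is thus a line, and it contains `ν` since `ν` is null and normal.
  let T : (E × ℝ) →ₗ[ℝ] W :=
    (fderiv ℝ Ψ q).toLinearMap.coprod (LinearMap.toSpanSingleton ℝ W (ν q))
  have hT : ∀ X a, T (X, a) = dirDeriv X Ψ q + a • ν q := fun X a => by simp [T, dirDeriv]
  have hTi : Function.Injective T := by
    rw [← LinearMap.ker_eq_bot, LinearMap.ker_eq_bot']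
    rintro ⟨V, a⟩ h
    rw [hT] at h
    have hV : V = 0 := by
      refine hB V fun Y => ?_
      have := congrArg (C (dirDeriv Y Ψ q)) h
      simp only [map_add, map_smul, hνΨ q hq, smul_zero, add_zero, map_zero] at this
      rw [← hiso q hq, hC, this]
    subst hV
    have : dirDeriv (0 : E) Ψ q = 0 := by simp [dirDeriv]
    rw [this, zero_add] at h
    have := (smul_eq_zero.1 h).resolve_right (hν0 q hq)
    simp [this]
  let R := LinearMap.range T
  have hR : Module.finrank ℝ R = Module.finrank ℝ E + 1 := by
    rw [LinearMap.finrank_range_of_inj hTi, Module.finrank_prod, Module.finrank_self]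
  have hnd : LinearMap.BilinForm.Nondegenerate C := by
    refine ⟨hCn, fun u h => hCn u fun w => ?_⟩
    rw [hC]; exact h w
  have hO : Module.finrank ℝ (LinearMap.BilinForm.orthogonal C R) = 1 := by
    rw [LinearMap.BilinForm.finrank_orthogonal hnd, hR, hdim]; omega
  have hmem : ∀ w, C w (ν q) = 0 → (∀ V, C w (dirDeriv V Ψ q) = 0) →
      w ∈ LinearMap.BilinForm.orthogonal C R := by
    intro w h1 h2
    rw [LinearMap.BilinForm.mem_orthogonal_iff]
    rintro _ ⟨⟨V, a⟩, rfl⟩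
    change C (T (V, a)) w = 0
    rw [hC, hT]
    simp [h1, h2]
  have hνm := hmem (ν q) (hνν q hq) (fun V => by rw [hC]; exact hνΨ q hq V)
  have hmul : ∀ w, C w (ν q) = 0 → (∀ V, C w (dirDeriv V Ψ q) = 0) → ∃ b : ℝ, b • ν q = w := by
    intro w h1 h2
    have := (finrank_eq_one_iff_of_nonzero' (⟨ν q, hνm⟩ : LinearMap.BilinForm.orthogonal C R)
      (by simpa using hν0 q hq)).1 hO ⟨w, hmem w h1 h2⟩
    obtain ⟨b, hb⟩ := this
    exact ⟨b, congrArg Subtype.val hb⟩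
  have hn := fun X Y V => isometric_second_deriv_normal hΩ hC hΨ hiso hq X V Y
  obtain ⟨b, hb⟩ := hmul _ (by rw [hdiff X Y, hXY, neg_zero]) (hn Y X)
  obtain ⟨b₁, hb₁⟩ := hmul _ (by rw [hdiff X Z, hXZ, neg_zero]) (hn Z X)
  obtain ⟨b₂, hb₂⟩ := hmul _ (by rw [hdiff Y Z, hYZ, neg_zero]) (hn Z Y)
  -- The right side pairs two multiples of the null vector `ν`, so it vanishes; the left side is `b`
  -- times the pairing of `ν` with `∂_Z ∂_Z Ψ`, which is nonzero by `hZZ`.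
  have hg := isometric_gauss hΩ hC hΨ hiso hq X Y Z
  rw [← hb, ← hb₁, ← hb₂] at hg
  simp only [map_smul, LinearMap.smul_apply, hνν q hq, smul_zero] at hg
  rw [hC, hdiff Z Z, smul_eq_mul] at hg
  have : b = 0 := (mul_eq_zero.1 hg).resolve_right (neg_ne_zero.2 hZZ)
  rw [← hb, this, zero_smul]

/-- The version of `isometric_second_deriv_eq_zero` for `Ψ = f ν + k` with `ν` a conformal map to
the light cone. -/
lemma conformal_lift_second_deriv_eq_zero [FiniteDimensional ℝ E] (hΩ : IsOpen Ω)
    (hB : ∀ X, (∀ Y, B X Y = 0) → X = 0)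
    (hC : ∀ u w, C u w = C w u) (hCn : ∀ u, (∀ w, C u w = 0) → u = 0)
    (hdim : Module.finrank ℝ W = Module.finrank ℝ E + 2)
    {ν k : E → W} {f η : E → ℝ} {h : E → E → E → ℝ} (hν : ContDiffOn ℝ ∞ ν Ω)
    (hk : ContDiffOn ℝ ∞ k Ω) (hf : ContDiffOn ℝ ∞ f Ω)
    (hfη : ∀ q ∈ Ω, f q ^ 2 * η q = 1)
    (hν0 : ∀ q ∈ Ω, ν q ≠ 0) (hνν : ∀ q ∈ Ω, C (ν q) (ν q) = 0)
    (hνd : ∀ q ∈ Ω, ∀ X Y, C (dirDeriv X ν q) (dirDeriv Y ν q) = η q * h q X Y)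
    (hkν : ∀ q ∈ Ω, ∀ X, C (dirDeriv X k q) (ν q) = 0)
    (hkνd : ∀ q ∈ Ω, ∀ X Y, C (dirDeriv X k q) (dirDeriv Y ν q) = 0)
    (hkd : ∀ q ∈ Ω, ∀ X Y, C (dirDeriv X k q) (dirDeriv Y k q) = B X Y - h q X Y)
    {q : E} (hq : q ∈ Ω) (X Y Z : E)
    (hXY : h q Y X = 0) (hXZ : h q Z X = 0) (hYZ : h q Z Y = 0) (hZZ : h q Z Z ≠ 0) :
    dirDeriv X (dirDeriv Y fun q => f q • ν q + k q) q = 0 := by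
  have hd : ∀ q ∈ Ω, ∀ X, dirDeriv X (fun q => f q • ν q + k q) q
      = f q • dirDeriv X ν q + dirDeriv X f q • ν q + dirDeriv X k q := by
    intro q hq X
    have h1 := differentiableAt_of_contDiffOn hΩ hf hq
    have h2 := differentiableAt_of_contDiffOn hΩ hν hq
    rw [dirDeriv_add (h1.fun_smul h2) (differentiableAt_of_contDiffOn hΩ hk hq), dirDeriv_smul h1 h2]
  have hνd0 : ∀ q ∈ Ω, ∀ X, C (dirDeriv X ν q) (ν q) = 0 := by
    intro q hq X
    have h2 := differentiableAt_of_contDiffOn hΩ hν hq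
    have := dirDeriv_congr hΩ hνν hq X
    rw [dirDeriv_bilin C h2 h2, dirDeriv_const, hC (ν q)] at this
    linarith
  have hsub : ∀ q ∈ Ω, ∀ X Y, C (dirDeriv X (fun q => f q • ν q + k q) q) (dirDeriv Y ν q)
      = f q * (η q * h q X Y) := by
    intro q hq X Y
    rw [hd q hq]
    simp [hνd q hq, hkνd q hq, hC (ν q), hνd0 q hq]
  have hfη' : ∀ q ∈ Ω, f q * η q ≠ 0 := by
    intro q hq h0
    have := hfη q hq
    rw [sq, mul_assoc, h0] at this
    simp at this
  refine isometric_second_deriv_eq_zero (B := B) (C := C)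
    (Ψ := fun q => f q • ν q + k q) hΩ hB hC hCn hdim
    ((hf.smul hν).add hk) ?_ hν hν0 hνν ?_ hq X Y Z ?_ ?_ ?_ ?_
  · intro q hq X Y
    rw [hd q hq, hd q hq]
    simp only [map_add, map_smul, LinearMap.add_apply, LinearMap.smul_apply, smul_eq_mul,
      hνd q hq, hνd0 q hq, hC (ν q) (dirDeriv _ _ _), hkν q hq, hkνd q hq, hkd q hq, hνν q hq,
      hC (dirDeriv _ ν q) (dirDeriv _ k q)]
    -- All terms with `df` drop out, as `ν` is null and orthogonal to `dν` and `dk`; what remains is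
    -- `f² η h + (B - h) = B`.
    linear_combination h q X Y * hfη q hq
  · intro q hq X
    rw [hd q hq]
    simp [hνd0 q hq, hνν q hq, hkν q hq]
  · rw [hsub q hq, hXY]; simp
  · rw [hsub q hq, hXZ]; simp
  · rw [hsub q hq, hYZ]; simp
  · rw [hsub q hq, ← mul_assoc]
    exact mul_ne_zero (hfη' q hq) hZZ

end Isometric

/-! ### The light cone lift of a conformal map. -/

section Lift

variable {E F G : Type*} [NormedAddCommGroup E] [NormedSpace ℝ E]
  [NormedAddCommGroup F] [NormedSpace ℝ F] [NormedAddCommGroup G] [NormedSpace ℝ G] {Ω : Set E}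

lemma dirDeriv_prodMk {f : E → F} {g : E → G} {q : E} (hf : DifferentiableAt ℝ f q)
    (hg : DifferentiableAt ℝ g q) (X : E) :
    dirDeriv X (fun q => (f q, g q)) q = (dirDeriv X f q, dirDeriv X g q) := by
  unfold dirDeriv
  rw [hf.fderiv_prodMk hg]; rfl

lemma dirDeriv_dirDeriv_linearMap [FiniteDimensional ℝ F] (hΩ : IsOpen Ω) (l : F →ₗ[ℝ] G)
    {f : E → F} (hf : ContDiffOn ℝ ∞ f Ω) {q : E} (hq : q ∈ Ω) (X Y : E) :
    dirDeriv X (dirDeriv Y fun q => l (f q)) q = l (dirDeriv X (dirDeriv Y f) q) := by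
  rw [dirDeriv_congr hΩ (fun q hq =>
    dirDeriv_linearMap l (differentiableAt_of_contDiffOn hΩ hf hq) Y) hq X,
    dirDeriv_linearMap l
      (differentiableAt_of_contDiffOn hΩ (contDiffOn_dirDeriv hΩ hf Y) hq)]

/-- The orthogonal sum of a bilinear form and the form `α a² + 2 β a b + γ b²`. -/
def sumForm (B : E →ₗ[ℝ] E →ₗ[ℝ] ℝ) (α β γ : ℝ) : (E × ℝ × ℝ) →ₗ[ℝ] (E × ℝ × ℝ) →ₗ[ℝ] ℝ :=
  LinearMap.mk₂ ℝ (fun u w => B u.1 w.1 + α * (u.2.1 * w.2.1)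
      + β * (u.2.1 * w.2.2 + u.2.2 * w.2.1) + γ * (u.2.2 * w.2.2))
    (by intros; simp; ring) (by intros; simp; ring) (by intros; simp; ring) (by intros; simp; ring)

lemma sumForm_apply (B : E →ₗ[ℝ] E →ₗ[ℝ] ℝ) (α β γ : ℝ) (u w : E × ℝ × ℝ) :
    sumForm B α β γ u w = B u.1 w.1 + α * (u.2.1 * w.2.1)
      + β * (u.2.1 * w.2.2 + u.2.2 * w.2.1) + γ * (u.2.2 * w.2.2) := rfl

/-- The Liouville-type rigidity of a conformal map `Φ` with factor `η = f⁻²`: if it lifts to the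
light cone by `(Φ, 1, t)`, the trace-free Hessians of `f` and `f Φ` vanish. -/
lemma conformal_second_deriv_eq_zero [FiniteDimensional ℝ E] {B : E →ₗ[ℝ] E →ₗ[ℝ] ℝ}
    (hΩ : IsOpen Ω) (hB : ∀ X, (∀ Y, B X Y = 0) → X = 0) (hBs : ∀ X Y, B X Y = B Y X)
    {α β γ : ℝ} (hdet : α * γ - β ^ 2 ≠ 0)
    {Φ : E → E} {f η t r : E → ℝ} {h : E → E → E → ℝ} (hΦ : ContDiffOn ℝ ∞ Φ Ω)
    (ht : ContDiffOn ℝ ∞ t Ω) (hr : ContDiffOn ℝ ∞ r Ω) (hf : ContDiffOn ℝ ∞ f Ω)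
    (hfη : ∀ q ∈ Ω, f q ^ 2 * η q = 1)
    (hnull : ∀ q ∈ Ω, B (Φ q) (Φ q) + α + 2 * β * t q + γ * t q ^ 2 = 0)
    (hconf : ∀ q ∈ Ω, ∀ X Y, B (dirDeriv X Φ q) (dirDeriv Y Φ q)
      + γ * (dirDeriv X t q * dirDeriv Y t q) = η q * h q X Y)
    (hrt : ∀ q ∈ Ω, ∀ X, dirDeriv X r q * (β + γ * t q) = 0)
    (hrtd : ∀ q ∈ Ω, ∀ X Y, γ * (dirDeriv X r q * dirDeriv Y t q) = 0)
    (hrd : ∀ q ∈ Ω, ∀ X Y, γ * (dirDeriv X r q * dirDeriv Y r q) = B X Y - h q X Y)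
    {q : E} (hq : q ∈ Ω) (X Y Z : E)
    (hXY : h q Y X = 0) (hXZ : h q Z X = 0) (hYZ : h q Z Y = 0) (hZZ : h q Z Z ≠ 0) :
    dirDeriv X (dirDeriv Y f) q = 0 ∧ dirDeriv X (dirDeriv Y fun q => f q • Φ q) q = 0 := by
  let ν : E → E × ℝ × ℝ := fun q => (Φ q, 1, t q)
  let k : E → E × ℝ × ℝ := fun q => (0, 0, r q)
  have hν : ContDiffOn ℝ ∞ ν Ω := hΦ.prodMk (contDiffOn_const.prodMk ht)
  have hk : ContDiffOn ℝ ∞ k Ω := contDiffOn_const.prodMk (contDiffOn_const.prodMk hr)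
  have hdν : ∀ q ∈ Ω, ∀ X, dirDeriv X ν q = (dirDeriv X Φ q, 0, dirDeriv X t q) := by
    intro q hq X
    have h1 := differentiableAt_of_contDiffOn hΩ hΦ hq
    have h2 := differentiableAt_of_contDiffOn hΩ ht hq
    have h3 : DifferentiableAt ℝ (fun _ : E => (1 : ℝ)) q := by fun_prop
    rw [dirDeriv_prodMk h1 (h3.prodMk h2), dirDeriv_prodMk h3 h2, dirDeriv_const]
  have hdk : ∀ q ∈ Ω, ∀ X, dirDeriv X k q = (0, 0, dirDeriv X r q) := by
    intro q hq X
    have h1 : DifferentiableAt ℝ (fun _ : E => (0 : E)) q := by fun_prop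
    have h2 := differentiableAt_of_contDiffOn hΩ hr hq
    have h3 : DifferentiableAt ℝ (fun _ : E => (0 : ℝ)) q := by fun_prop
    rw [dirDeriv_prodMk h1 (h3.prodMk h2), dirDeriv_prodMk h3 h2, dirDeriv_const, dirDeriv_const]
  have key := conformal_lift_second_deriv_eq_zero (B := B) (C := sumForm B α β γ) (ν := ν) (k := k)
    hΩ hB ?_ ?_ ?_ hν hk hf hfη ?_ ?_ ?_ ?_ ?_ ?_ hq X Y Z hXY hXZ hYZ hZZ
  · have hsm : ContDiffOn ℝ ∞ (fun q => f q • ν q + k q) Ω := (hf.smul hν).add hk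
    constructor
    -- The middle coordinate of `f ν + k` is `f`, and its `E` component is `f Φ`; linear projections
    -- commute with differentiation.
    · have := dirDeriv_dirDeriv_linearMap hΩ
        (LinearMap.fst ℝ ℝ ℝ ∘ₗ LinearMap.snd ℝ E (ℝ × ℝ)) hsm hq X Y
      rw [key, map_zero] at this
      simpa [ν, k] using this
    · have := dirDeriv_dirDeriv_linearMap hΩ (LinearMap.fst ℝ E (ℝ × ℝ)) hsm hq X Y
      rw [key, map_zero] at this
      simpa [ν, k] using this
  · intro u w
    rw [sumForm_apply, sumForm_apply, hBs]; ring
  · intro u hu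
    have h1 : u.1 = 0 := hB _ fun Y => by simpa [sumForm_apply] using hu (Y, 0, 0)
    have h2 := hu (0, 1, 0)
    have h3 := hu (0, 0, 1)
    simp only [sumForm_apply, map_zero, mul_one, mul_zero, zero_add, add_zero] at h2 h3
    -- Cramer's rule for the binary form with determinant `α γ - β²`.
    have h4 : u.2.1 = 0 := (mul_eq_zero.1 (by linear_combination γ * h2 - β * h3 :
      (α * γ - β ^ 2) * u.2.1 = 0)).resolve_left hdet
    have h5 : u.2.2 = 0 := (mul_eq_zero.1 (by linear_combination α * h3 - β * h2 :
      (α * γ - β ^ 2) * u.2.2 = 0)).resolve_left hdet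
    exact Prod.ext h1 (Prod.ext h4 h5)
  · simp [Module.finrank_prod]
  · intro q hq h0
    have := congrArg (fun u => u.2.1) h0
    simp [ν] at this
  · intro q hq
    rw [sumForm_apply, ← hnull q hq]; simp only [ν]; ring
  · intro q hq X Y
    rw [hdν q hq, hdν q hq, sumForm_apply, ← hconf q hq]; simp
  · intro q hq X
    rw [hdk q hq, sumForm_apply]; simp [ν]; linear_combination hrt q hq X
  · intro q hq X Y
    rw [hdk q hq, hdν q hq, sumForm_apply]; simpa using hrtd q hq X Y
  · intro q hq X Y
    rw [hdk q hq, hdk q hq, sumForm_apply, ← hrd q hq X Y]; simp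

end Lift

/-! ### Rigidity of conformal maps extended to the linear space. -/

section Extension

variable {c : SignType} {n : ℕ} {Ω : Set (Ambient c n)} {Φ : Ambient c n → Ambient c n}
  {η : Ambient c n → ℝ}

lemma ambientBilin_single_right (X : Ambient c n) (i : Fin (ambientDim c n)) :
    ambientBilin c n X (Pi.single i 1) = (if i.val < ambientIndex c then -1 else 1) * X i := by
  simp only [ambientBilin_apply, ambientInner, pseudoInner]
  rw [Finset.sum_eq_single i]
  · simp
  · intro j _ hj
    simp [hj]
  · simp

lemma ambientBilin_nondegenerate (X : Ambient c n) (h : ∀ Y, ambientBilin c n X Y = 0) :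
    X = 0 := by
  ext i
  have := h (Pi.single i 1)
  rw [ambientBilin_single_right] at this
  split_ifs at this <;> simpa using this

/-- `Φ` is a smooth map from an open subset of the linear space containing `M^{n+1}_1(c)` to
`M^{n+1}_1(c)`, degenerate in the radial direction if `c ≠ 0` and otherwise conformal with
factor `η`. -/
structure IsConformalExtension (Ω : Set (Ambient c n)) (Φ : Ambient c n → Ambient c n)
    (η : Ambient c n → ℝ) : Prop where
  isOpen : IsOpen Ω
  smooth : ContDiffOn ℝ ∞ Φ Ω
  smooth_factor : ContDiffOn ℝ ∞ η Ω
  factor_pos : ∀ q ∈ Ω, 0 < η q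
  mem : c ≠ 0 → ∀ q ∈ Ω, ambientBilin c n (Φ q) (Φ q) = (c : ℝ)
  domain : c ≠ 0 → ∀ q ∈ Ω, 0 < (c : ℝ) * ambientBilin c n q q
  conformal : ∀ q ∈ Ω, ∀ X Y, ambientBilin c n (dirDeriv X Φ q) (dirDeriv Y Φ q)
    = η q * (ambientBilin c n X Y
      - (c : ℝ) ^ 2 * (ambientBilin c n q X * ambientBilin c n q Y) / ambientBilin c n q q)

lemma sq_cast_of_ne_zero (hc : c ≠ 0) : (c : ℝ) ^ 2 = 1 := by
  cases c <;> simp_all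

/-- The inverse square root of the conformal factor. -/
def invScale (η : Ambient c n → ℝ) (q : Ambient c n) : ℝ := (√(η q))⁻¹

namespace IsConformalExtension

variable (h : IsConformalExtension Ω Φ η)
include h

lemma invScale_pos {q : Ambient c n} (hq : q ∈ Ω) : 0 < invScale η q :=
  inv_pos.2 (Real.sqrt_pos.2 (h.factor_pos q hq))

lemma invScale_sq_mul {q : Ambient c n} (hq : q ∈ Ω) : invScale η q ^ 2 * η q = 1 := by
  rw [invScale, inv_pow, Real.sq_sqrt (h.factor_pos q hq).le]
  exact inv_mul_cancel₀ (h.factor_pos q hq).ne'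

lemma smooth_invScale : ContDiffOn ℝ ∞ (invScale η) Ω :=
  (h.smooth_factor.sqrt fun q hq => (h.factor_pos q hq).ne').inv
    fun q hq => (Real.sqrt_pos.2 (h.factor_pos q hq)).ne'

/-- The three space forms share the light cone argument and differ only in the lift. For `c ≠ 0`,
tangency of `X`, `Y`, `Z` to the quadric through `q` makes the radially degenerate form agree with
the ambient product on them. -/
lemma second_deriv_eq_zero {q : Ambient c n} (hq : q ∈ Ω) {X Y Z : Ambient c n}
    (hXY : ambientBilin c n X Y = 0) (hXZ : ambientBilin c n X Z = 0)
    (hYZ : ambientBilin c n Y Z = 0) (hZZ : ambientBilin c n Z Z ≠ 0)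
    (hX : c ≠ 0 → ambientBilin c n q X = 0) (hY : c ≠ 0 → ambientBilin c n q Y = 0)
    (hZ : c ≠ 0 → ambientBilin c n q Z = 0) :
    dirDeriv X (dirDeriv Y (invScale η)) q = 0 ∧
      dirDeriv X (dirDeriv Y fun q => invScale η q • Φ q) q = 0 := by
  have hΩ := h.isOpen
  rw [ambientBilin_comm] at hXY hXZ hYZ
  have smΦΦ := contDiffOn_bilin (ambientBilin c n) h.smooth h.smooth
  by_cases hc : c = 0
  · have hc0 : (c : ℝ) = 0 := by simp [hc]
    -- The paraboloid lift `(Φ, 1, ⟨Φ, Φ⟩)` is null for `⟨ , ⟩` plus the form `-a b`. Nothing is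
    -- lost radially, so `k = 0`.
    refine conformal_second_deriv_eq_zero (B := ambientBilin c n) (α := 0) (β := -1 / 2) (γ := 0)
      (h := fun _ X Y => ambientBilin c n X Y) (r := fun _ => 0) hΩ ambientBilin_nondegenerate
      ambientBilin_comm (by norm_num) h.smooth smΦΦ contDiffOn_const h.smooth_invScale
      (fun q hq => h.invScale_sq_mul hq) ?_ ?_ ?_ ?_ ?_ hq X Y Z hXY hXZ hYZ hZZ
    · intro q hq; ring
    · intro q hq X Y
      rw [h.conformal q hq, hc0]; ring
    · intro q hq X; rw [dirDeriv_const]; ring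
    · intro q hq X Y; ring
    · intro q hq X Y; ring
  · have hc2 := sq_cast_of_ne_zero hc
    have hb : ∀ q ∈ Ω, ambientBilin c n q q ≠ 0 := fun q hq h0 => by
      have := h.domain hc q hq
      rw [h0] at this; simp at this
    have smid : ContDiffOn ℝ ∞ (fun q : Ambient c n => (c : ℝ) * ambientBilin c n q q) Ω :=
      contDiffOn_const.mul (contDiffOn_bilin (ambientBilin c n) contDiffOn_id contDiffOn_id)
    have hr : ∀ q ∈ Ω, ∀ X, dirDeriv X (fun q => √((c : ℝ) * ambientBilin c n q q)) q
        = (c : ℝ) * ambientBilin c n q X / √((c : ℝ) * ambientBilin c n q q) := by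
      intro q hq X
      have h1 : HasFDerivAt (fun q : Ambient c n => (c : ℝ) * ambientBilin c n q q) _ q :=
        ((HasFDerivAt.comp q (f := fun q => (q, q)) (hasFDerivAt_bilin (ambientBilin c n) (q, q))
          ((hasFDerivAt_id q).prodMk (hasFDerivAt_id q))).const_mul (c : ℝ))
      have h2 := h1.sqrt (h.domain hc q hq).ne'
      have h3 : dirDeriv X (fun q => √((c : ℝ) * ambientBilin c n q q)) q
          = (1 / (2 * √((c : ℝ) * ambientBilin c n q q))) *
            ((c : ℝ) * (ambientBilin c n q X + ambientBilin c n X q)) :=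
        congrArg (fun T => T X) h2.fderiv
      rw [h3, ambientBilin_comm X q]
      have := (Real.sqrt_pos.2 (h.domain hc q hq)).ne'
      field_simp
      ring
    -- Since `⟨Φ, Φ⟩ = c`, the lift `(Φ, 1, 0)` is null for `⟨ , ⟩ - c a² + c b²`. The last
    -- coordinate is free for the radius `r = √(c ⟨q, q⟩)`, and `c dr²` is exactly the missing
    -- radial part of the metric.
    refine conformal_second_deriv_eq_zero (B := ambientBilin c n) (α := -c) (β := 0) (γ := c)
      (h := fun q X Y => ambientBilin c n X Y
        - (c : ℝ) ^ 2 * (ambientBilin c n q X * ambientBilin c n q Y) / ambientBilin c n q q)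
      (t := fun _ => 0) (r := fun q => √((c : ℝ) * ambientBilin c n q q)) hΩ
      ambientBilin_nondegenerate
      ambientBilin_comm ?_ h.smooth contDiffOn_const
      (smid.sqrt fun q hq => (h.domain hc q hq).ne') h.smooth_invScale
      (fun q hq => h.invScale_sq_mul hq) ?_ ?_ ?_ ?_ ?_ hq X Y Z ?_ ?_ ?_ ?_
    · rw [show -(c : ℝ) * c - 0 ^ 2 = -(c : ℝ) ^ 2 by ring, hc2]; norm_num
    · intro q hq; rw [h.mem hc q hq]; ring
    · intro q hq X Y
      rw [h.conformal q hq, dirDeriv_const]; ring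
    · intro q hq X; ring
    · intro q hq X Y; rw [dirDeriv_const]; ring
    · intro q hq X Y
      rw [hr q hq, hr q hq, div_mul_div_comm, Real.mul_self_sqrt (h.domain hc q hq).le]
      have := hb q hq
      have hcn : (c : ℝ) ≠ 0 := fun h0 => by rw [h0] at hc2; norm_num at hc2
      field_simp
      ring
    · simp [hXY, hX hc]
    · simp [hXZ, hX hc]
    · simp [hYZ, hY hc]
    · simpa [hZ hc] using hZZ

end IsConformalExtension

end Extension

/-! ### Radial extension of a conformal transformation. -/

section Existence

variable {c : SignType} {n : ℕ} {Ω U : Set (Ambient c n)} {Φ φ : Ambient c n → Ambient c n}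
  {η : Ambient c n → ℝ}

/-- The trace of the ambient product over itself is the dimension; for `c ≠ 0` projecting away the
radial direction removes one. Both cases leave `n + 1`, a nonzero constant by which the factor can
be recovered. -/
lemma trace_tangent_form {q : Ambient c n} (hq : c ≠ 0 → ambientBilin c n q q ≠ 0) :
    ∑ i : Fin (ambientDim c n), (if i.val < ambientIndex c then -1 else 1) *
      (ambientBilin c n (Pi.single i 1) (Pi.single i 1)
        - (c : ℝ) ^ 2 * (ambientBilin c n q (Pi.single i 1) * ambientBilin c n q (Pi.single i 1))
          / ambientBilin c n q q) = (n + 1 : ℝ) := by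
  have h1 : ∀ i : Fin (ambientDim c n), (if i.val < ambientIndex c then -1 else 1) *
      (ambientBilin c n (Pi.single i 1) (Pi.single i 1)
        - (c : ℝ) ^ 2 * (ambientBilin c n q (Pi.single i 1) * ambientBilin c n q (Pi.single i 1))
          / ambientBilin c n q q) = 1 - (c : ℝ) ^ 2 / ambientBilin c n q q *
            ((if i.val < ambientIndex c then -1 else 1) * (q i * q i)) := by
    intro i
    simp only [ambientBilin_single_right, Pi.single_eq_same]
    split_ifs <;> ring
  have h2 : ∑ i : Fin (ambientDim c n), (if i.val < ambientIndex c then (-1 : ℝ) else 1)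
      * (q i * q i) = ambientBilin c n q q := rfl
  rw [Finset.sum_congr rfl fun i _ => h1 i, Finset.sum_sub_distrib, ← Finset.mul_sum, h2,
    Finset.sum_const, Finset.card_univ, Fintype.card_fin]
  by_cases hc : c = 0
  · simp [ambientDim, hc]
  · have := hq hc
    rw [sq_cast_of_ne_zero hc, one_div, inv_mul_cancel₀ this]
    simp [ambientDim, hc]
    ring

/-- The conformal factor is smooth since it is a trace. -/
lemma contDiffOn_factor (hΩ : IsOpen Ω) (hΦ : ContDiffOn ℝ ∞ Φ Ω)
    (hdom : c ≠ 0 → ∀ q ∈ Ω, 0 < (c : ℝ) * ambientBilin c n q q)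
    (hconf : ∀ q ∈ Ω, ∀ X Y, ambientBilin c n (dirDeriv X Φ q) (dirDeriv Y Φ q)
      = η q * (ambientBilin c n X Y
        - (c : ℝ) ^ 2 * (ambientBilin c n q X * ambientBilin c n q Y) / ambientBilin c n q q)) :
    ContDiffOn ℝ ∞ η Ω := by
  have key : ∀ q ∈ Ω, η q = (∑ i : Fin (ambientDim c n),
      (if i.val < ambientIndex c then -1 else 1) * ambientBilin c n
        (dirDeriv (Pi.single i 1) Φ q) (dirDeriv (Pi.single i 1) Φ q)) / (n + 1 : ℝ) := by
    intro q hq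
    have h0 : c ≠ 0 → ambientBilin c n q q ≠ 0 := fun hc h0 => by
      have := hdom hc q hq
      rw [h0] at this; simp at this
    rw [eq_div_iff (by positivity), ← trace_tangent_form h0, Finset.mul_sum]
    refine Finset.sum_congr rfl fun i _ => ?_
    rw [hconf q hq]; ring
  refine ContDiffOn.congr (ContDiffOn.div_const (ContDiffOn.sum fun i _ => ?_) _) key
  have := contDiffOn_dirDeriv hΩ hΦ (Pi.single i (1 : ℝ))
  exact contDiffOn_const.mul (contDiffOn_bilin (ambientBilin c n) this this)

/-- A conformal transformation extends to an open subset of the surrounding linear space, constant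
in the radial direction. -/
lemma IsConformalTransformation.exists_extension (h : IsConformalTransformation c n U φ) :
    ∃ Ω Φ η, IsConformalExtension (c := c) (n := n) Ω Φ η ∧ U ⊆ Ω ∧ Set.EqOn Φ φ U := by
  obtain ⟨W, hW, rfl⟩ := h.isOpen_domain
  have hdiff : ∀ p ∈ W ∩ spaceForm c n, HasFDerivWithinAt φ
      (fderivWithin ℝ φ (W ∩ spaceForm c n) p) (W ∩ spaceForm c n) p := fun p hp =>
    ((h.smooth p hp).differentiableWithinAt (by simp)).hasFDerivWithinAt
  choose! μ hμ hconf using h.conformal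
  by_cases hc : c = 0
  · have hU : W ∩ spaceForm c n = W := by
      ext p; simp [spaceForm, hc]
    have hsm := h.smooth
    rw [hU] at hsm hμ hconf ⊢
    have hc0 : (c : ℝ) = 0 := by simp [hc]
    have hcf : ∀ q ∈ W, ∀ X Y, ambientBilin c n (dirDeriv X φ q) (dirDeriv Y φ q)
      = μ q * (ambientBilin c n X Y
        - (c : ℝ) ^ 2 * (ambientBilin c n q X * ambientBilin c n q Y) / ambientBilin c n q q) := by
      intro q hq X Y
      have := hconf q hq X (fun h => absurd hc h) Y (fun h => absurd hc h)
      rw [fderivWithin_of_isOpen hW hq] at this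
      rw [hc0]
      simpa [ambientBilin_apply, dirDeriv] using this
    exact ⟨W, φ, μ, ⟨hW, hsm, contDiffOn_factor hW hsm (fun h => absurd hc h) hcf, hμ,
      fun h => absurd hc h, fun h => absurd hc h, hcf⟩, subset_rfl, fun _ _ => rfl⟩
  · have hc2 := sq_cast_of_ne_zero hc
    let D : Set (Ambient c n) := {q | 0 < (c : ℝ) * ambientBilin c n q q}
    let s : Ambient c n → ℝ := fun q => (√((c : ℝ) * ambientBilin c n q q))⁻¹
    -- Radial projection of the cone `D` onto the quadric; `φ ∘ P` is the extension.
    let P : Ambient c n → Ambient c n := fun q => s q • q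
    have smq : ContDiff ℝ ∞ (fun q : Ambient c n => (c : ℝ) * ambientBilin c n q q) :=
      contDiffOn_univ.1 (contDiffOn_const.mul
        (contDiffOn_bilin (ambientBilin c n) contDiffOn_id contDiffOn_id))
    have hDpos : ∀ q ∈ D, 0 < (c : ℝ) * ambientBilin c n q q := fun q hq => hq
    have hD : IsOpen D := isOpen_lt continuous_const smq.continuous
    have hs : ContDiffOn ℝ ∞ s D :=
      (smq.contDiffOn.sqrt fun q hq => (hDpos q hq).ne').inv
        fun q hq => (Real.sqrt_pos.2 (hDpos q hq)).ne'
    have hspos : ∀ q ∈ D, 0 < s q := fun q hq => inv_pos.2 (Real.sqrt_pos.2 (hDpos q hq))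
    have hP : ContDiffOn ℝ ∞ P D := hs.smul contDiffOn_id
    have hPs : ∀ q ∈ D, ambientBilin c n (P q) (P q) = (c : ℝ) := by
      intro q hq
      have h1 : s q * s q * ((c : ℝ) * ambientBilin c n q q) = 1 := by
        simp only [s]
        rw [← mul_inv, Real.mul_self_sqrt (hDpos q hq).le]
        exact inv_mul_cancel₀ (hDpos q hq).ne'
      simp only [P, map_smul, LinearMap.smul_apply, smul_eq_mul]
      linear_combination (c : ℝ) * h1 - s q * s q * ambientBilin c n q q * hc2
    let Ω : Set (Ambient c n) := D ∩ P ⁻¹' W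
    have hΩ : IsOpen Ω := hP.continuousOn.isOpen_inter_preimage hD hW
    have hmaps : Set.MapsTo P Ω (W ∩ spaceForm c n) := fun q hq => ⟨hq.2, fun _ => hPs q hq.1⟩
    have hPΩ : ContDiffOn ℝ ∞ P Ω := hP.mono Set.inter_subset_left
    have hΦ : ContDiffOn ℝ ∞ (φ ∘ P) Ω := h.smooth.comp hPΩ hmaps
    have hdP : ∀ q ∈ Ω, ∀ X, dirDeriv X P q = s q • X + dirDeriv X s q • q := by
      intro q hq X
      refine (dirDeriv_smul (differentiableAt_of_contDiffOn hD hs hq.1) (g := fun q => q)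
        differentiableAt_fun_id X).trans ?_
      simp [dirDeriv]
    have hPP : ∀ q ∈ Ω, ∀ X, ambientBilin c n (P q) (dirDeriv X P q) = 0 := by
      intro q hq X
      have h2 := differentiableAt_of_contDiffOn hΩ hPΩ hq
      have := dirDeriv_congr hD hPs hq.1 X
      rw [dirDeriv_bilin _ h2 h2, dirDeriv_const, ambientBilin_comm (dirDeriv X P q)] at this
      linarith
    have hcf : ∀ q ∈ Ω, ∀ X Y,
        ambientBilin c n (dirDeriv X (φ ∘ P) q) (dirDeriv Y (φ ∘ P) q)
        = (μ (P q) * s q ^ 2) * (ambientBilin c n X Y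
        - (c : ℝ) ^ 2 * (ambientBilin c n q X * ambientBilin c n q Y) / ambientBilin c n q q) := by
      intro q hq X Y
      -- `φ` is only differentiable within its domain, but `P` maps the open set `Ω` into that
      -- domain, so the composite has a genuine derivative.
      have hd := (hdiff (P q) (hmaps hq)).comp_hasFDerivAt q
        (differentiableAt_of_contDiffOn hΩ hPΩ hq).hasFDerivAt
        (Filter.eventually_of_mem (hΩ.mem_nhds hq) hmaps)
      have hX : ∀ X, dirDeriv X (φ ∘ P) q
          = fderivWithin ℝ φ (W ∩ spaceForm c n) (P q) (dirDeriv X P q) :=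
        fun X => congrArg (fun T => T X) hd.fderiv
      have hbq : ambientBilin c n q q ≠ 0 := fun h0 => by
        have : 0 < (c : ℝ) * ambientBilin c n q q := hq.1
        rw [h0] at this; simp at this
      -- Tangency of `∂_X P` to the quadric determines `∂_X s`; thus `∂_X P` is `s` times the part
      -- of `X` orthogonal to `q`, which yields the factor `μ(P q) s²`.
      have hsX : ∀ X, dirDeriv X s q = - s q * ambientBilin c n q X / ambientBilin c n q q := by
        intro X
        have := hPP q hq X
        rw [hdP q hq] at this
        simp only [P, map_smul, map_add, LinearMap.smul_apply, smul_eq_mul] at this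
        have := (mul_eq_zero.1 (by linear_combination this : s q * (s q * ambientBilin c n q X
          + dirDeriv X s q * ambientBilin c n q q) = 0)).resolve_left (hspos q hq.1).ne'
        field_simp
        linarith
      rw [hX, hX]
      refine (hconf (P q) (hmaps hq) _ (fun _ => hPP q hq X) _ (fun _ => hPP q hq Y)).trans ?_
      rw [← ambientBilin_apply, hdP q hq, hdP q hq, hsX, hsX, hc2]
      simp only [map_smul, map_add, LinearMap.smul_apply, LinearMap.add_apply, smul_eq_mul,
        ambientBilin_comm X q]
      field_simp
      ring
    have hdom : c ≠ 0 → ∀ q ∈ Ω, 0 < (c : ℝ) * ambientBilin c n q q := fun _ q hq => hq.1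
    have hPU : ∀ p ∈ W ∩ spaceForm c n, p ∈ D ∧ P p = p := by
      intro p hp
      have h1 : (c : ℝ) * ambientBilin c n p p = 1 := by
        rw [ambientBilin_apply, hp.2 hc, ← sq, hc2]
      refine ⟨?_, ?_⟩
      · change 0 < (c : ℝ) * ambientBilin c n p p
        rw [h1]; exact one_pos
      · simp [P, s, h1]
    refine ⟨Ω, φ ∘ P, fun q => μ (P q) * s q ^ 2, ⟨hΩ, hΦ, contDiffOn_factor hΩ hΦ hdom hcf,
      fun q hq => mul_pos (hμ _ (hmaps hq)) (pow_pos (hspos q hq.1) 2),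
      fun hc q hq => h.mapsTo (hmaps hq) hc, hdom, hcf⟩, fun p hp => ⟨(hPU p hp).1, ?_⟩,
      fun p hp => ?_⟩
    · rw [Set.mem_preimage, (hPU p hp).2]; exact hp.1
    · rw [Function.comp_apply, (hPU p hp).2]

end Existence

/-! ### Differentiation of maps defined on a manifold. -/

section Manifold

/-- Read in a chart, the function has zero derivative on a convex ball, so it is locally constant;
connectedness does the rest. -/
lemma eq_of_mfderiv_eq_zero {m : ℕ} {S : Type*} [TopologicalSpace S]
    [ChartedSpace (EuclideanSpace ℝ (Fin m)) S] [IsManifold (𝓡 m) ∞ S] [ConnectedSpace S]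
    {g : S → ℝ} (hg : ∀ s, HasMFDerivAt (𝓡 m) 𝓘(ℝ, ℝ) g s 0) (s t : S) : g s = g t := by
  have : IsManifold (𝓡 m) 1 S := IsManifold.of_le (n := ∞) (by simp)
  suffices h : IsLocallyConstant g from h.apply_eq_of_isPreconnected isPreconnected_univ trivial trivial
  rw [IsLocallyConstant.iff_eventually_eq]
  intro s
  let e := chartAt (EuclideanSpace ℝ (Fin m)) s
  have he : e ∈ atlas (EuclideanSpace ℝ (Fin m)) S := chart_mem_atlas _ s
  obtain ⟨r, hr, hb⟩ := Metric.isOpen_iff.1 e.open_target (e s)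
    (e.map_source (mem_chart_source _ s))
  have hd : ∀ y ∈ Metric.ball (e s) r, HasFDerivAt (g ∘ e.symm) (0 : _ →L[ℝ] ℝ) y := by
    intro y hy
    have h1 := (mdifferentiableAt_atlas_symm (I := 𝓡 m) he (hb hy)).hasMFDerivAt
    have h2 := (hg (e.symm y)).comp y h1
    rw [ContinuousLinearMap.zero_comp] at h2
    exact hasMFDerivAt_iff_hasFDerivAt.1 h2
  have hconst : ∀ y ∈ Metric.ball (e s) r, (g ∘ e.symm) y = (g ∘ e.symm) (e s) := by
    intro y hy
    refine (convex_ball (e s) r).is_const_of_fderivWithin_eq_zero (𝕜 := ℝ)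
      (fun z hz => (hd z hz).differentiableAt.differentiableWithinAt) (fun z hz => ?_) hy
      (Metric.mem_ball_self hr)
    rw [fderivWithin_of_isOpen Metric.isOpen_ball hz, (hd z hz).fderiv]
  have hcont : ContinuousAt e s := e.continuousAt (mem_chart_source _ s)
  filter_upwards [hcont.preimage_mem_nhds (Metric.ball_mem_nhds (e s) hr),
    e.open_source.mem_nhds (mem_chart_source _ s)] with y hy hy'
  have := hconst (e y) hy
  simpa [e.left_inv hy', e.left_inv (mem_chart_source _ s)] using this

variable {m : ℕ} {S : Type*} [TopologicalSpace S] [ChartedSpace (EuclideanSpace ℝ (Fin m)) S]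
  {E G : Type*} [NormedAddCommGroup E] [NormedSpace ℝ E] [NormedAddCommGroup G] [NormedSpace ℝ G]
  {Ω : Set E}

lemma hasMFDerivAt_comp_of_contDiffOn (hΩ : IsOpen Ω) {F : E → G} (hF : ContDiffOn ℝ ∞ F Ω)
    {a : S → E} {s : S} (has : a s ∈ Ω) {a' : TangentSpace (𝓡 m) s →L[ℝ] E}
    (ha : HasMFDerivAt (𝓡 m) 𝓘(ℝ, E) a s a') :
    HasMFDerivAt (𝓡 m) 𝓘(ℝ, G) (F ∘ a) s ((fderiv ℝ F (a s)).comp a') :=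
  HasMFDerivAt.comp s (differentiableAt_of_contDiffOn hΩ hF has).hasFDerivAt.hasMFDerivAt ha

/-- The product rule for the derivative of `F` along `a` in the direction `b`. -/
lemma hasMFDerivAt_dirDeriv (hΩ : IsOpen Ω) {F : E → G} (hF : ContDiffOn ℝ ∞ F Ω)
    {a b : S → E} {s : S} (has : a s ∈ Ω) {a' b' : TangentSpace (𝓡 m) s →L[ℝ] E}
    (ha : HasMFDerivAt (𝓡 m) 𝓘(ℝ, E) a s a') (hb : HasMFDerivAt (𝓡 m) 𝓘(ℝ, E) b s b') :
    ∃ D : TangentSpace (𝓡 m) s →L[ℝ] G,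
      HasMFDerivAt (𝓡 m) 𝓘(ℝ, G) (fun s => dirDeriv (b s) F (a s)) s D ∧
      ∀ v, D v = dirDeriv (a' v) (dirDeriv (b s) F) (a s) + dirDeriv (b' v) F (a s) := by
  have h1 : HasFDerivAt (fun u : E × E => fderiv ℝ F u.1)
      ((fderiv ℝ (fderiv ℝ F) (a s)).comp (ContinuousLinearMap.fst ℝ E E)) (a s, b s) :=
    HasFDerivAt.comp (a s, b s) (f := Prod.fst)
      (differentiableAt_of_contDiffOn hΩ (contDiffOn_fderiv hΩ hF) has).hasFDerivAt hasFDerivAt_fst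
  have h2 := h1.clm_apply (hasFDerivAt_snd (𝕜 := ℝ) (p := (a s, b s)))
  have hab : HasMFDerivAt (𝓡 m) 𝓘(ℝ, E × E) (fun s => (a s, b s)) s (a'.prod b') :=
    ⟨ha.1.prodMk hb.1, ha.2.prodMk hb.2⟩
  refine ⟨_, HasMFDerivAt.comp s (g := fun u : E × E => fderiv ℝ F u.1 u.2) h2.hasMFDerivAt hab,
    fun v => ?_⟩
  rw [dirDeriv_dirDeriv hΩ hF has, add_comm]
  rfl

lemma hasMFDerivAt_smul {f : S → ℝ} {g : S → G} {s : S} {f' : TangentSpace (𝓡 m) s →L[ℝ] ℝ}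
    {g' : TangentSpace (𝓡 m) s →L[ℝ] G}
    (hf : HasMFDerivAt (𝓡 m) 𝓘(ℝ, ℝ) f s f') (hg : HasMFDerivAt (𝓡 m) 𝓘(ℝ, G) g s g') :
    ∃ D : TangentSpace (𝓡 m) s →L[ℝ] G,
      HasMFDerivAt (𝓡 m) 𝓘(ℝ, G) (fun s => f s • g s) s D ∧
      ∀ v, D v = f s • g' v + f' v • g s := by
  have h : HasFDerivAt (fun u : ℝ × G => u.1 • u.2) _ (f s, g s) :=
    (hasFDerivAt_fst (𝕜 := ℝ) (p := (f s, g s))).fun_smul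
      (hasFDerivAt_snd (𝕜 := ℝ) (p := (f s, g s)))
  have hfg : HasMFDerivAt (𝓡 m) 𝓘(ℝ, ℝ × G) (fun s => (f s, g s)) s (f'.prod g') :=
    ⟨hf.1.prodMk hg.1, hf.2.prodMk hg.2⟩
  exact ⟨_, HasMFDerivAt.comp s (g := fun u : ℝ × G => u.1 • u.2) h.hasMFDerivAt hfg,
    fun v => rfl⟩

lemma contMDiff_dirDeriv (hΩ : IsOpen Ω) {F : E → G} (hF : ContDiffOn ℝ ∞ F Ω)
    {a b : S → E} (haΩ : ∀ s, a s ∈ Ω) (ha : ContMDiff (𝓡 m) 𝓘(ℝ, E) ∞ a)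
    (hb : ContMDiff (𝓡 m) 𝓘(ℝ, E) ∞ b) :
    ContMDiff (𝓡 m) 𝓘(ℝ, G) ∞ (fun s => dirDeriv (b s) F (a s)) := by
  have h : ContMDiff (𝓡 m) 𝓘(ℝ, E →L[ℝ] G) ∞ (fun s => fderiv ℝ F (a s)) :=
    (contDiffOn_fderiv hΩ hF).contMDiffOn.comp_contMDiff ha haΩ
  exact h.clm_apply hb

end Manifold

/-! ### Shape operators and curvature surfaces under conformal maps. -/

section Hypersurface

universe u

variable {c : SignType} {n : ℕ}
  {M : Type u} [TopologicalSpace M] [ChartedSpace (EuclideanSpace ℝ (Fin n)) M]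
  {x ξ : M → Ambient c n} {Ω : Set (Ambient c n)} {Φ : Ambient c n → Ambient c n}
  {η : Ambient c n → ℝ}

lemma hasMFDerivAt_of_contMDiff {f : M → Ambient c n}
    (hf : ContMDiff (𝓡 n) 𝓘(ℝ, Ambient c n) ∞ f) (p : M) :
    HasMFDerivAt (𝓡 n) 𝓘(ℝ, Ambient c n) f p (mfderiv (𝓡 n) 𝓘(ℝ, Ambient c n) f p) :=
  ((hf p).mdifferentiableAt (by simp)).hasMFDerivAt

lemma differential_apply_of_hasMFDerivAt {f : M → Ambient c n} {p : M}
    {f' : TangentSpace (𝓡 n) p →L[ℝ] Ambient c n}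
    (h : HasMFDerivAt (𝓡 n) 𝓘(ℝ, Ambient c n) f p f') (v : TangentSpace (𝓡 n) p) :
    differential f p v = f' v :=
  congrArg (fun T => T v) h.mfderiv

lemma differential_comp (hΩ : IsOpen Ω) (hΦ : ContDiffOn ℝ ∞ Φ Ω) {f : M → Ambient c n}
    (hf : ContMDiff (𝓡 n) 𝓘(ℝ, Ambient c n) ∞ f) {p : M} (hp : f p ∈ Ω)
    (v : TangentSpace (𝓡 n) p) :
    differential (Φ ∘ f) p v = dirDeriv (differential f p v) Φ (f p) :=
  differential_apply_of_hasMFDerivAt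
    (hasMFDerivAt_comp_of_contDiffOn hΩ hΦ hp (hasMFDerivAt_of_contMDiff hf p)) v

lemma IsSpacelikeHypersurface.differential_injective (hx : IsSpacelikeHypersurface x) (p : M) :
    Function.Injective (differential x p) := by
  rw [← LinearMap.ker_eq_bot, LinearMap.ker_eq_bot']
  intro w hw
  by_contra h0
  have := hx.spacelike p w h0
  rw [hw, ← ambientBilin_apply] at this
  simp at this

lemma IsSpacelikeHypersurface.tangent (hx : IsSpacelikeHypersurface x) (hc : c ≠ 0) (p : M)
    (v : TangentSpace (𝓡 n) p) : ambientBilin c n (x p) (differential x p v) = 0 := by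
  have := ambientBilin_differential x x hx.smooth hx.smooth (c : ℝ) (fun q => hx.mem q hc) p v
  rw [ambientBilin_comm (differential x p v)] at this
  linarith

lemma IsSpacelikeHypersurface.exists_orthogonal (hn : 2 ≤ n) (hx : IsSpacelikeHypersurface x)
    (p : M) (v : TangentSpace (𝓡 n) p) : ∃ w : TangentSpace (𝓡 n) p,
      ambientBilin c n (differential x p v) (differential x p w) = 0 ∧
      ambientBilin c n (differential x p w) (differential x p w) ≠ 0 := by
  have : FiniteDimensional ℝ (TangentSpace (𝓡 n) p) :=
    inferInstanceAs (FiniteDimensional ℝ (EuclideanSpace ℝ (Fin n)))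
  have hfr : Module.finrank ℝ (TangentSpace (𝓡 n) p) = n := by
    change Module.finrank ℝ (EuclideanSpace ℝ (Fin n)) = n
    simp
  -- A linear functional on a space of dimension at least two has a nonzero kernel vector, and the
  -- induced metric is positive definite on it.
  have h := LinearMap.ker_ne_bot_of_finrank_lt
    (f := ambientBilin c n (differential x p v) ∘ₗ differential x p)
    (by rw [hfr, Module.finrank_self]; omega)
  obtain ⟨w, hw, hw0⟩ := Submodule.exists_mem_ne_zero_of_ne_bot h
  exact ⟨w, hw, (hx.spacelike p w hw0).ne'⟩

/-- The unit normal field of `Φ ∘ x`. -/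
def imageNormal (x ξ : M → Ambient c n) (Φ : Ambient c n → Ambient c n) (η : Ambient c n → ℝ)
    (p : M) : Ambient c n :=
  invScale η (x p) • dirDeriv (ξ p) Φ (x p)

/-- The radial correction is a product of one factor in `X` and one in `Y`, so it suffices that a
single argument is tangent. -/
lemma IsConformalExtension.conformal_tangent (h : IsConformalExtension Ω Φ η)
    {q : Ambient c n} (hq : q ∈ Ω) (X : Ambient c n) {Y : Ambient c n}
    (hY : c ≠ 0 → ambientBilin c n q Y = 0) :
    ambientBilin c n (dirDeriv X Φ q) (dirDeriv Y Φ q) = η q * ambientBilin c n X Y := by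
  rw [h.conformal q hq]
  by_cases hc : c = 0
  · simp [hc]
  · simp [hY hc]

lemma IsConformalExtension.isSpacelikeHypersurface_comp (h : IsConformalExtension Ω Φ η)
    (hx : IsSpacelikeHypersurface x) (hxΩ : ∀ p, x p ∈ Ω) :
    IsSpacelikeHypersurface (Φ ∘ x) where
  smooth := h.smooth.contMDiffOn.comp_contMDiff hx.smooth hxΩ
  mem p hc := h.mem hc _ (hxΩ p)
  spacelike p v hv := by
    rw [differential_comp h.isOpen h.smooth hx.smooth (hxΩ p), ← ambientBilin_apply,
      h.conformal_tangent (hxΩ p) _ fun hc => hx.tangent hc p v]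
    exact mul_pos (h.factor_pos _ (hxΩ p)) (hx.spacelike p v hv)

lemma IsConformalExtension.isUnitNormal_imageNormal (h : IsConformalExtension Ω Φ η)
    (hx : IsSpacelikeHypersurface x) (hξ : IsUnitNormal x ξ) (hxΩ : ∀ p, x p ∈ Ω) :
    IsUnitNormal (Φ ∘ x) (imageNormal x ξ Φ η) where
  smooth := by
    have h1 : ContMDiff (𝓡 n) 𝓘(ℝ, ℝ) ∞ (fun p => invScale η (x p)) :=
      h.smooth_invScale.contMDiffOn.comp_contMDiff hx.smooth hxΩ
    exact h1.smul (contMDiff_dirDeriv h.isOpen h.smooth hxΩ hx.smooth hξ.smooth)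
  tangent p hc := by
    have hd := differentiableAt_of_contDiffOn h.isOpen h.smooth (hxΩ p)
    -- Differentiating `⟨Φ, Φ⟩ = c` puts the image of `dΦ` in the tangent space at `Φ(x p)`.
    have h1 := dirDeriv_congr h.isOpen (h.mem hc) (hxΩ p) (ξ p)
    rw [dirDeriv_bilin _ hd hd, dirDeriv_const, ambientBilin_comm (dirDeriv _ _ _)] at h1
    rw [← ambientBilin_apply, imageNormal, map_smul, Function.comp_apply,
      show ambientBilin c n (Φ (x p)) (dirDeriv (ξ p) Φ (x p)) = 0 by linarith, smul_zero]
  normal p v := by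
    rw [differential_comp h.isOpen h.smooth hx.smooth (hxΩ p), ← ambientBilin_apply, imageNormal,
      map_smul, LinearMap.smul_apply,
      h.conformal_tangent (hxΩ p) _ fun hc => hx.tangent hc p v,
      show ambientBilin c n (ξ p) (differential x p v) = 0 from hξ.normal p v]
    simp
  unit p := by
    rw [← ambientBilin_apply, imageNormal, map_smul, map_smul, LinearMap.smul_apply,
      h.conformal_tangent (hxΩ p) _ fun hc => hξ.tangent p hc,
      show ambientBilin c n (ξ p) (ξ p) = -1 from hξ.unit p, smul_eq_mul, smul_eq_mul]
    linear_combination - h.invScale_sq_mul (hxΩ p)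

lemma IsConformalExtension.second_deriv_normal (h : IsConformalExtension Ω Φ η) (hn : 2 ≤ n)
    (hx : IsSpacelikeHypersurface x) (hξ : IsUnitNormal x ξ) (hxΩ : ∀ p, x p ∈ Ω) (p : M)
    (v : TangentSpace (𝓡 n) p) :
    dirDeriv (differential x p v) (dirDeriv (ξ p) (invScale η)) (x p) = 0 ∧
      dirDeriv (differential x p v) (dirDeriv (ξ p) fun q => invScale η q • Φ q) (x p) = 0 := by
  obtain ⟨w, hvw, hww⟩ := hx.exists_orthogonal hn p v
  exact h.second_deriv_eq_zero (hxΩ p) ((ambientBilin_comm _ _).trans (hξ.normal p v)) hvw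
    (hξ.normal p w) hww (fun hc => hx.tangent hc p v) (fun hc => hξ.tangent p hc)
    (fun hc => hx.tangent hc p w)

/-- Only the mixed Hessians in the directions `dx v` and `ξ` occur, and the rigidity kills them; the
two terms `df(dξ v) Φ` cancel. -/
lemma IsConformalExtension.differential_imageNormal (h : IsConformalExtension Ω Φ η) (hn : 2 ≤ n)
    (hx : IsSpacelikeHypersurface x) (hξ : IsUnitNormal x ξ) (hxΩ : ∀ p, x p ∈ Ω) (p : M)
    (v : TangentSpace (𝓡 n) p) :
    differential (imageNormal x ξ Φ η) p v
      = invScale η (x p) • dirDeriv (differential ξ p v) Φ (x p)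
        - dirDeriv (ξ p) (invScale η) (x p) • dirDeriv (differential x p v) Φ (x p) := by
  have hΩ := h.isOpen
  have hsm : ContDiffOn ℝ ∞ (fun q => invScale η q • Φ q) Ω := h.smooth_invScale.smul h.smooth
  have hd : ∀ p X, dirDeriv X (fun q => invScale η q • Φ q) (x p)
      = invScale η (x p) • dirDeriv X Φ (x p) + dirDeriv X (invScale η) (x p) • Φ (x p) :=
    fun p X => dirDeriv_smul (differentiableAt_of_contDiffOn hΩ h.smooth_invScale (hxΩ p))
      (differentiableAt_of_contDiffOn hΩ h.smooth (hxΩ p)) X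
  -- The product rule for `f Φ` replaces `dΦ(ξ)`, whose derivative is not controlled, by first
  -- derivatives of `f Φ` and `f`, whose Hessians are.
  have heq : imageNormal x ξ Φ η = fun p => dirDeriv (ξ p) (fun q => invScale η q • Φ q) (x p)
      - dirDeriv (ξ p) (invScale η) (x p) • (Φ ∘ x) p := by
    ext1 p
    rw [hd, imageNormal, Function.comp_apply, add_sub_cancel_right]
  have hx' := hasMFDerivAt_of_contMDiff hx.smooth p
  have hξ' := hasMFDerivAt_of_contMDiff hξ.smooth p
  obtain ⟨D₁, hD₁, e₁⟩ := hasMFDerivAt_dirDeriv hΩ hsm (hxΩ p) hx' hξ'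
  obtain ⟨D₂, hD₂, e₂⟩ := hasMFDerivAt_dirDeriv hΩ h.smooth_invScale (hxΩ p) hx' hξ'
  have hD₃ := hasMFDerivAt_comp_of_contDiffOn hΩ h.smooth (hxΩ p) hx'
  obtain ⟨D₄, hD₄, e₄⟩ := hasMFDerivAt_smul hD₂ hD₃
  have key : differential (imageNormal x ξ Φ η) p v = D₁ v - D₄ v := by
    rw [heq]
    exact differential_apply_of_hasMFDerivAt (hD₁.sub hD₄) v
  obtain ⟨z₁, z₂⟩ := h.second_deriv_normal hn hx hξ hxΩ p v
  have f₁ : D₁ v = dirDeriv (differential ξ p v) (fun q => invScale η q • Φ q) (x p) := by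
    rw [e₁ v]; exact add_eq_right.2 z₂
  have f₂ : D₂ v = dirDeriv (differential ξ p v) (invScale η) (x p) := by
    rw [e₂ v]; exact add_eq_right.2 z₁
  have f₄ : D₄ v = dirDeriv (ξ p) (invScale η) (x p) • dirDeriv (differential x p v) Φ (x p)
      + D₂ v • Φ (x p) := e₄ v
  rw [key, f₄, f₂, f₁, hd]
  abel

/-- The shape operators of `x` and `Φ ∘ x`. -/
lemma IsConformalExtension.shapeOperator_comp (h : IsConformalExtension Ω Φ η) (hn : 2 ≤ n)
    (hx : IsSpacelikeHypersurface x) (hξ : IsUnitNormal x ξ) (hxΩ : ∀ p, x p ∈ Ω) (p : M)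
    (v : TangentSpace (𝓡 n) p) :
    shapeOperator (Φ ∘ x) (imageNormal x ξ Φ η) p v
      = invScale η (x p) • shapeOperator x ξ p v + dirDeriv (ξ p) (invScale η) (x p) • v := by
  have hx' := h.isSpacelikeHypersurface_comp hx hxΩ
  apply hx'.differential_injective p
  rw [shapeOperator_spec hx' (h.isUnitNormal_imageNormal hx hξ hxΩ),
    h.differential_imageNormal hn hx hξ hxΩ, map_add, map_smul, map_smul,
    differential_comp h.isOpen h.smooth hx.smooth (hxΩ p),
    differential_comp h.isOpen h.smooth hx.smooth (hxΩ p), shapeOperator_spec hx hξ]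
  simp only [dirDeriv, map_neg, smul_neg]
  abel

/-- The new shape operator is `f A + df(ξ) I` with `f > 0`, so eigenspaces persist under an affine
change of eigenvalue. -/
lemma IsConformalExtension.eigenspace_shapeOperator_comp (h : IsConformalExtension Ω Φ η)
    (hn : 2 ≤ n) (hx : IsSpacelikeHypersurface x) (hξ : IsUnitNormal x ξ) (hxΩ : ∀ p, x p ∈ Ω)
    (p : M) (l : ℝ) :
    (shapeOperator (Φ ∘ x) (imageNormal x ξ Φ η) p).eigenspace l
      = (shapeOperator x ξ p).eigenspace
          ((l - dirDeriv (ξ p) (invScale η) (x p)) / invScale η (x p)) := by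
  have hf := (h.invScale_pos (hxΩ p)).ne'
  ext v
  rw [Module.End.mem_eigenspace_iff, Module.End.mem_eigenspace_iff,
    h.shapeOperator_comp hn hx hξ hxΩ, div_eq_inv_mul, mul_smul, eq_inv_smul_iff₀ hf, sub_smul,
    eq_sub_iff_add_eq]

lemma IsConformalExtension.isCurvatureSurface_of_comp (h : IsConformalExtension Ω Φ η)
    (hn : 2 ≤ n) (hx : IsSpacelikeHypersurface x) (hξ : IsUnitNormal x ξ) (hxΩ : ∀ p, x p ∈ Ω)
    {m : ℕ} {S : Type u} [TopologicalSpace S] [ChartedSpace (EuclideanSpace ℝ (Fin m)) S]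
    {ι : S → M} {l : S → ℝ}
    (hl : IsCurvatureSurface (Φ ∘ x) (imageNormal x ξ Φ η) m ι l) :
    IsCurvatureSurface x ξ m ι fun s =>
      (l s - dirDeriv (ξ (ι s)) (invScale η) (x (ι s))) / invScale η (x (ι s)) where
  isImmersion := hl.isImmersion
  injective := hl.injective
  principalCurvature s := by
    have := hl.principalCurvature s
    change Module.End.eigenspace _ _ ≠ ⊥ at this
    change Module.End.eigenspace _ _ ≠ ⊥
    rwa [← h.eigenspace_shapeOperator_comp hn hx hξ hxΩ]
  tangentSpace_eq s := by
    rw [hl.tangentSpace_eq, h.eigenspace_shapeOperator_comp hn hx hξ hxΩ]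

/-- Along a curvature surface with constant principal curvature `a`, the principal curvature of
`Φ ∘ x` is constant. -/
lemma IsConformalExtension.principalCurvature_const (h : IsConformalExtension Ω Φ η)
    (hn : 2 ≤ n) (hx : IsSpacelikeHypersurface x) (hξ : IsUnitNormal x ξ) (hxΩ : ∀ p, x p ∈ Ω)
    {m : ℕ} {S : Type u} [TopologicalSpace S] [ChartedSpace (EuclideanSpace ℝ (Fin m)) S]
    [IsManifold (𝓡 m) ∞ S] [ConnectedSpace S] {ι : S → M} {a : ℝ}
    (ha : IsCurvatureSurface x ξ m ι fun _ => a) (s t : S) :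
    a * invScale η (x (ι s)) + dirDeriv (ξ (ι s)) (invScale η) (x (ι s))
      = a * invScale η (x (ι t)) + dirDeriv (ξ (ι t)) (invScale η) (x (ι t)) := by
  refine eq_of_mfderiv_eq_zero (m := m) (g := fun s => a * invScale η (x (ι s))
    + dirDeriv (ξ (ι s)) (invScale η) (x (ι s))) (fun s => ?_) s t
  have hΩ := h.isOpen
  have hι : HasMFDerivAt (𝓡 m) (𝓡 n) ι s (mfderiv (𝓡 m) (𝓡 n) ι s) :=
    ((ha.isImmersion.contMDiff s).mdifferentiableAt (by simp)).hasMFDerivAt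
  have hx' := (hasMFDerivAt_of_contMDiff hx.smooth (ι s)).comp s hι
  have hξ' := (hasMFDerivAt_of_contMDiff hξ.smooth (ι s)).comp s hι
  obtain ⟨D₁, hD₁, e₁⟩ :=
    hasMFDerivAt_dirDeriv (a := x ∘ ι) (b := ξ ∘ ι) hΩ h.smooth_invScale (hxΩ _) hx' hξ'
  have hD₂ := hasMFDerivAt_comp_of_contDiffOn (a := x ∘ ι) hΩ h.smooth_invScale (hxΩ _) hx'
  obtain ⟨D₃, hD₃, e₃⟩ := hasMFDerivAt_smul (hasMFDerivAt_const a s) hD₂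
  suffices h0 : D₃ + D₁ = 0 by
    have := hD₃.add hD₁
    rw [h0] at this
    exact this
  ext w
  set v := mfderiv (𝓡 m) (𝓡 n) ι s w with hv
  have hvm : v ∈ (shapeOperator x ξ (ι s)).eigenspace a := by
    rw [← ha.tangentSpace_eq s]
    exact ⟨w, rfl⟩
  -- Rodrigues' formula: it makes `df(dξ v)` cancel `a df(dx v)`.
  have hdξ : differential ξ (ι s) v = - a • differential x (ι s) v := by
    have := shapeOperator_spec hx hξ (ι s) v
    rw [Module.End.mem_eigenspace_iff.1 hvm, map_smul] at this
    rw [neg_smul, this, neg_neg]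
  have f₁ : D₁ w = dirDeriv (differential ξ (ι s) v) (invScale η) (x (ι s)) :=
    (e₁ w).trans (add_eq_right.2 (h.second_deriv_normal hn hx hξ hxΩ (ι s) v).1)
  have f₃ : D₃ w = a * dirDeriv (differential x (ι s) v) (invScale η) (x (ι s)) := by
    rw [e₃ w]
    have : (0 : TangentSpace (𝓡 m) s →L[ℝ] ℝ) w • invScale η (x (ι s)) = 0 := by simp
    exact add_eq_left.2 this
  change D₃ w + D₁ w = 0
  rw [f₁, f₃, hdξ]
  simp [dirDeriv]

lemma IsConformalExtension.isSpacelikeDupin_comp (h : IsConformalExtension Ω Φ η)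
    (hn : 2 ≤ n) (hx : IsSpacelikeDupin x) (hxΩ : ∀ p, x p ∈ Ω) : IsSpacelikeDupin (Φ ∘ x) := by
  obtain ⟨hx, ξ, hξ, hD⟩ := hx
  refine ⟨h.isSpacelikeHypersurface_comp hx hxΩ, imageNormal x ξ Φ η,
    h.isUnitNormal_imageNormal hx hξ hxΩ, fun m S _ _ _ _ ι l hl s t => ?_⟩
  -- A curvature surface of the image is pulled back to one of `x`, where the Dupin hypothesis makes
  -- the curvature a constant `a`.
  have hcs := h.isCurvatureSurface_of_comp hn hx hξ hxΩ hl
  have hconst := hD m S ι _ hcs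
  obtain ⟨a, ha⟩ : ∃ a : ℝ, (fun s => (l s - dirDeriv (ξ (ι s)) (invScale η) (x (ι s)))
      / invScale η (x (ι s))) = fun _ => a := ⟨_, funext fun s' => hconst s' s⟩
  rw [ha] at hcs
  have hl' : ∀ s, l s = a * invScale η (x (ι s)) + dirDeriv (ξ (ι s)) (invScale η) (x (ι s)) := by
    intro s
    have := congrFun ha s
    rw [div_eq_iff (h.invScale_pos (hxΩ _)).ne'] at this
    linarith
  rw [hl' s, hl' t]
  exact h.principalCurvature_const hn hx hξ hxΩ hcs s t

end Hypersurface

end LorentzDupin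

end

theorem mainTheorem5 (c : SignType) (n : ℕ) (hn : 2 ≤ n)
    (M : Type*) [TopologicalSpace M] [ChartedSpace (EuclideanSpace ℝ (Fin n)) M]
    [IsManifold (𝓡 n) ∞ M]
    (x : M → LorentzDupin.Ambient c n) (hx : LorentzDupin.IsSpacelikeDupin x)
    (U : Set (LorentzDupin.Ambient c n))
    (φ : LorentzDupin.Ambient c n → LorentzDupin.Ambient c n)
    (hφ : LorentzDupin.IsConformalTransformation c n U φ) (hxU : ∀ p, x p ∈ U) :
    LorentzDupin.IsSpacelikeDupin (φ ∘ x) := by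
  obtain ⟨Ω, Φ, η, h, hUΩ, hΦ⟩ := hφ.exists_extension
  rw [← show Φ ∘ x = φ ∘ x from funext fun p => hΦ (hxU p)]
  exact h.isSpacelikeDupin_comp hn hx fun p => hUΩ (hxU p)
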